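/- Let $p,q\ge 3$ be integers with $\frac1p+\frac1q\le\frac12$, and let $G$ be the $\{p,q\}$ lattice, i.e. the infinite graph formed by the vertices and edges of the regular tessellation of the Euclidean or hyperbolic plane by $p$-gons, $q$ of which meet at each vertex. Fix a vertex $o$ of $G$ and define induced subgraphs $G_0\subseteq G_1\subseteq\cdots$ of $G$ by $V(G_0)=\{o\}$ and $V(G_{n+1})=V(G_n)\cup V'_{n+1}\cup V''_{n+1}$, where - $V'_{n+1}$ is the set of vertices outside $V(G_n)$ that are adjacent to some vertex of $G_n$; - $V''_{n+1}$ is the set of vertices outside $V(G_n)\cup V'_{n+1}$ that lie on a cycle of $p$ vertices of $G$ containing some vertex of $G_n$. For $n\ge1$ put $s_1(n)=|V'_n|$, $s_2(n)=|V''_n|$, $s(n)=|V(G_n)\setminus V(G_{n-1})|$ and $b(n)=|E(G_n)\setminus E(G_{n-1})|$, and put $s(0)=|V(G_0)|=1$. Then every $G_n$ is finite, and for all $n\ge0$ $$|V(G_n)|=\sum_{k=0}^n s(k),\qquad |E(G_n)|=\sum_{k=1}^n b(k).$$ (a) If $p,q>3$, then $s_1(1)=q$, $s_2(1)=(p-3)q$,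 $b(1)=(p-1)q$, and for all $n\ge1$ $$s(n)=s_1(n)+s_2(n),\qquad b(n)=2s_1(n)+s_2(n),$$ $$s_1(n+1)=(q-3)s_1(n)+(q-2)s_2(n),$$ $$s_2(n+1)=(p-3)\,[s_1(n+1)-s(n)]+(p-4)\,s(n).$$ (b) If $p=3$, then $s(0)=1$, $s(1)=q$, $s(2)=q(q-4)$, $$s(n+1)=(q-4)\,s(n)-s(n-1)\quad\text{for all } n\ge2,$$ $$b(n+1)=2s(n+1)+s(n)\quad\text{for all } n\ge1.$$ -/

import Mathlib

/-- The Coxeter matrix of the group `[p,q]` generated by the reflections `r₀, r₁, r₂` in the sides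
of a triangle with angles `π/p` (between `r₀` and `r₁`), `π/q` (between `r₁` and `r₂`) and `π/2`
(between `r₀` and `r₂`). This triangle is one piece of the barycentric subdivision of the regular
tessellation `{p,q}`: its corners are a vertex (fixed by `r₁, r₂`), the midpoint of an edge at that
vertex (fixed by `r₀, r₂`) and the centre of a `p`-gon at that edge (fixed by `r₀, r₁`). -/
def tilingCoxeterMatrix (p q : ℕ) (hp : 3 ≤ p) (hq : 3 ≤ q) : CoxeterMatrix (Fin 3) where
  M := !![1, p, 2; p, 1, q; 2, q, 1]
  isSymm := by
    ext i j
    fin_cases i <;> fin_cases j <;> rfl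
  diagonal := by
    intro i
    fin_cases i <;> rfl
  off_diagonal := by
    intro i j hij
    fin_cases i <;> fin_cases j <;> simp at hij ⊢ <;> omega

/-- The symmetry group of the regular tessellation `{p,q}`: the Coxeter group `[p,q]`, with
generators `r₀, r₁, r₂` and relations `rᵢ² = (r₀r₁)^p = (r₁r₂)^q = (r₀r₂)² = 1`. -/
abbrev TilingGroup (p q : ℕ) (hp : 3 ≤ p) (hq : 3 ≤ q) : Type :=
  (tilingCoxeterMatrix p q hp hq).Group

/-- The reflections `r₀`, `r₁`, `r₂`. -/
def tilingReflection (p q : ℕ) (hp : 3 ≤ p) (hq : 3 ≤ q) (i : Fin 3) : TilingGroup p q hp hq :=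
  (tilingCoxeterMatrix p q hp hq).simple i

/-- The vertices of the tessellation `{p,q}`: the symmetry group acts transitively on them, and the
stabilizer of the base vertex is the dihedral group generated by `r₁` and `r₂`; the coset of `g` is
the image of the base vertex under `g`. -/
abbrev TilingVertex (p q : ℕ) (hp : 3 ≤ p) (hq : 3 ≤ q) : Type :=
  TilingGroup p q hp hq ⧸
    Subgroup.closure {tilingReflection p q hp hq 1, tilingReflection p q hp hq 2}

/-- The `{p,q}` lattice, as a graph: the edges are the images under the symmetry group of the base
edge, which joins the base vertex to its mirror image under `r₀`. -/
def tilingGraph (p q : ℕ) (hp : 3 ≤ p) (hq : 3 ≤ q) : SimpleGraph (TilingVertex p q hp hq) :=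
  SimpleGraph.fromRel fun v w =>
    ∃ g : TilingGroup p q hp hq,
      v = QuotientGroup.mk g ∧ w = QuotientGroup.mk (g * tilingReflection p q hp hq 0)

namespace SimpleGraph

variable {V : Type*} (G : SimpleGraph V)

/-- The vertices outside `A` that are joined by an edge to a vertex of `A`. -/
def edgeNeighbors (A : Set V) : Set V :=
  {v | v ∉ A ∧ ∃ v' ∈ A, G.Adj v v'}

/-- The vertices outside `A`, and not joined by an edge to `A`, that lie on a common cycle of
`p` vertices with some vertex of `A`. -/
def cycleNeighbors (p : ℕ) (A : Set V) : Set V :=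
  {v | v ∉ A ∪ G.edgeNeighbors A ∧ ∃ v' ∈ A, ∃ (u : V) (c : G.Walk u u),
    c.IsCycle ∧ c.length = p ∧ v ∈ c.support ∧ v' ∈ c.support}

/-- The vertex set `V(G_n)` of the layering of `G` around the vertex `o`. -/
def layerBall (p : ℕ) (o : V) : ℕ → Set V
  | 0 => {o}
  | n + 1 => layerBall p o n ∪ G.edgeNeighbors (layerBall p o n) ∪
      G.cycleNeighbors p (layerBall p o n)

/-- The graph `G_n`: the subgraph of `G` induced on `V(G_n)`. -/
def layerSubgraph (p : ℕ) (o : V) (n : ℕ) : G.Subgraph :=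
  (⊤ : G.Subgraph).induce (G.layerBall p o n)

/-- The set `V'_n`, meaningful for `n ≥ 1`. -/
def layerFirst (p : ℕ) (o : V) : ℕ → Set V
  | 0 => ∅
  | n + 1 => G.edgeNeighbors (G.layerBall p o n)

/-- The set `V''_n`, meaningful for `n ≥ 1`. -/
def layerSecond (p : ℕ) (o : V) : ℕ → Set V
  | 0 => ∅
  | n + 1 => G.cycleNeighbors p (G.layerBall p o n)

/-- The vertices of the `n`-th layer: `V(G_0)` for `n = 0`, and `V(G_n) \ V(G_{n-1})` for
`n ≥ 1`. -/
def layerVerts (p : ℕ) (o : V) : ℕ → Set V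
  | 0 => G.layerBall p o 0
  | n + 1 => G.layerBall p o (n + 1) \ G.layerBall p o n

/-- The edges added in step `n`: `E(G_0)` (which is empty) for `n = 0`, and
`E(G_n) \ E(G_{n-1})` for `n ≥ 1`. -/
def layerEdges (p : ℕ) (o : V) : ℕ → Set (Sym2 V)
  | 0 => (G.layerSubgraph p o 0).edgeSet
  | n + 1 => (G.layerSubgraph p o (n + 1)).edgeSet \ (G.layerSubgraph p o n).edgeSet

/-- `s_1(n) = |V'_n|`. -/
noncomputable def s₁ (p : ℕ) (o : V) (n : ℕ) : ℕ := (G.layerFirst p o n).ncard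

/-- `s_2(n) = |V''_n|`. -/
noncomputable def s₂ (p : ℕ) (o : V) (n : ℕ) : ℕ := (G.layerSecond p o n).ncard

/-- `s(n)`, the number of vertices of the `n`-th layer. -/
noncomputable def s (p : ℕ) (o : V) (n : ℕ) : ℕ := (G.layerVerts p o n).ncard

/-- `b(n)`, the number of edges added in step `n`. -/
noncomputable def b (p : ℕ) (o : V) (n : ℕ) : ℕ := (G.layerEdges p o n).ncard

end SimpleGraph

/-!
The proof replaces the tessellation by an explicit model in which the layers around a vertex can
be read off.

The model. Apart from its centre, the model consists of cyclic sequences of vertices, the layers.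
In the layer that follows a layer `L`, every vertex `v` of `L` is replaced by a block of
consecutive vertices: if `v` has `k` edges going up, then these end `p - 2` steps apart, so that
together with the edge of `L` that follows `v` they cut the strip between the two layers into
`p`-gons. The number `k` is fixed by the requirement that `v` has degree `q`: two edges run inside
`L`, and the number of edges going down is known from the preceding step. This is well defined
when `p, q > 3`, or when `p = 3` and `q ≥ 6`; the case `q = 3` occurs only in the claim about
finiteness, which follows for all `p` and `q` from the local finiteness of the lattice
(`SimpleGraph.finite_layerBall`).

The model is the tessellation. On the darts (directed edges) of the model there are two
permutations, the rotation `rot` about the initial vertex and the reversal `flip`. Every vertex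
has `q` darts, the reversal is an involution, and every face has `p` sides (`face_pow`). These are
the relations of the Coxeter group `[p,q]`, which therefore acts on the flags of the model
(`flagAction`). Conversely, the recursive description of the layers attaches a group element to
each dart (`develop`), compatibly with `rot` and `flip` (`develop_rot`, `develop_flip`). The two
maps between group elements and flags are inverse to each other, which gives an isomorphism
between the lattice and the graph of the model that takes any given vertex to the centre
(`exists_iso`). No geometry of the plane is needed.

The layers. The graph `G_n` of the model consists of the vertices of height at most `n`
(`layerBall_model`). Every vertex of height `n + 1` is adjacent to, or lies on a `p`-gon with, a
vertex of height `n` (`exists_face_cycle`). Conversely, for `p > 3`, a cycle of length `p` through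
a vertex of height at most `n` does not pass above height `n + 1` (`height_le_of_cycle`): an arc
of it above that height would have at most `p - 4` edges, apart from the two by which it goes up
and down, and collapsing blocks to the vertices they belong to would turn it into a path of at
most that length inside the layer of height `n + 2`. But two vertices of a layer with an edge
going down are at least `p - 3` steps apart, so the arc would go up and down along the same edge.
For `p = 3` there is nothing to prove, as the vertices of a triangle are adjacent
(`cycleNeighbors_three`).

The recursions. Counting the edges at the vertices of a layer gives the number of edges to the
next layer (`numRungs_succ`), counting the elements of the blocks gives the number of vertices of
the next layer (`numVerts_succ`), and each vertex of a layer accounts for one edge inside the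
layer (`model_b_succ`).
-/

namespace TilingModel

/-! ### Cyclic odometers -/

/-- Pairs `(v, i)` with `i ≤ m v`: the set `C` with each element `v` replaced by a block of
`m v + 1` elements. -/
abbrev Blocks (C : Type) (m : C → ℕ) : Type := {x : C × ℕ // x.2 ≤ m x.1}

/-- The successor on blocks: it runs through the block of `v` and then passes to the start of the
block of `σ v`. -/
def odometer {C : Type} (σ : Equiv.Perm C) (m : C → ℕ) : Equiv.Perm (Blocks C m) where
  toFun x := if h : x.1.2 < m x.1.1 then ⟨(x.1.1, x.1.2 + 1), h⟩ else ⟨(σ x.1.1, 0), Nat.zero_le _⟩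
  invFun x := if x.1.2 = 0 then ⟨(σ.symm x.1.1, m (σ.symm x.1.1)), le_rfl⟩
    else ⟨(x.1.1, x.1.2 - 1), (Nat.sub_le _ _).trans x.2⟩
  left_inv := by
    rintro ⟨⟨v, i⟩, h⟩
    simp only at h
    by_cases hi : i < m v
    · simp [hi]
    · have : i = m v := by omega
      subst this
      simp
  right_inv := by
    rintro ⟨⟨v, i⟩, h⟩
    simp only at h
    by_cases hi : i = 0
    · subst hi
      simp
    · have h1 : i - 1 < m v := by omega
      have h2 : i - 1 + 1 = i := by omega
      simp [hi, h1, h2]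

section Odometer

variable {C : Type} (σ : Equiv.Perm C) (m : C → ℕ)

theorem odometer_of_lt {v : C} {i : ℕ} (h : i ≤ m v) (hi : i < m v) :
    odometer σ m ⟨(v, i), h⟩ = ⟨(v, i + 1), hi⟩ := by
  simp [odometer, hi]

theorem odometer_last {v : C} {i : ℕ} (h : i ≤ m v) (hi : i = m v) :
    odometer σ m ⟨(v, i), h⟩ = ⟨(σ v, 0), Nat.zero_le _⟩ := by
  simp [odometer, hi]

theorem odometer_iterate {v : C} {i : ℕ} (j : ℕ) (h : i ≤ m v) (hi : i + j ≤ m v) :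
    (odometer σ m)^[j] ⟨(v, i), h⟩ = ⟨(v, i + j), hi⟩ := by
  induction j with
  | zero => rfl
  | succ j ih =>
    rw [Function.iterate_succ_apply', ih (by omega), odometer_of_lt σ m _ (by omega)]
    rfl

theorem odometer_exists_iterate (x : Blocks C m) :
    ∃ j, (odometer σ m)^[j + 1] x = ⟨(σ x.1.1, 0), Nat.zero_le _⟩ := by
  obtain ⟨⟨v, i⟩, h⟩ := x
  simp only at h
  refine ⟨m v - i, ?_⟩
  rw [Function.iterate_succ_apply', odometer_iterate σ m _ h (by omega),
    odometer_last σ m _ (by omega)]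

theorem odometer_fst (x : Blocks C m) :
    (odometer σ m x).1.1 = x.1.1 ∨ (odometer σ m x).1.1 = σ x.1.1 := by
  obtain ⟨⟨v, i⟩, h⟩ := x
  simp only at h
  by_cases hi : i < m v
  · left; rw [odometer_of_lt σ m h hi]
  · right; rw [odometer_last σ m h (by omega)]

theorem odometer_ne (h1 : ∀ v, σ v ≠ v) (x : Blocks C m) : odometer σ m x ≠ x := by
  obtain ⟨⟨v, i⟩, h⟩ := x
  simp only at h
  by_cases hi : i < m v
  · rw [odometer_of_lt σ m h hi]; simp
  · rw [odometer_last σ m h (by omega)]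
    simp [h1 v]

theorem odometer_odometer_ne (h1 : ∀ v, σ v ≠ v) (h2 : ∀ v, σ (σ v) ≠ v) (x : Blocks C m) :
    odometer σ m (odometer σ m x) ≠ x := by
  obtain ⟨⟨v, i⟩, h⟩ := x
  simp only at h
  by_cases hi : i < m v
  · rw [odometer_of_lt σ m h hi]
    by_cases hi' : i + 1 < m v
    · rw [odometer_of_lt σ m _ hi']
      simp [add_assoc]
    · rw [odometer_last σ m _ (by omega)]
      simp [h1 v]
  · rw [odometer_last σ m h (by omega)]
    by_cases hi' : 0 < m (σ v)
    · rw [odometer_of_lt σ m _ hi']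
      simp [h1 v]
    · rw [odometer_last σ m _ (by omega)]
      simp [h2 v]

end Odometer

/-! ### The layers of the model -/

/-- A layer of vertices: the set of its vertices, the counterclockwise successor, and for each
vertex the number of its edges to the previous layer. -/
structure Layer where
  /-- The vertices of the layer. -/
  C : Type
  /-- The counterclockwise successor of a vertex. -/
  next : Equiv.Perm C
  /-- The number of neighbours of a vertex in the previous layer. -/
  par : C → ℕ

/-- The number of edges from `v` to the next layer: there are `q` edges at `v`, of which two run
inside the layer. -/
def Layer.kids (q : ℕ) (L : Layer) (v : L.C) : ℕ := q - 2 - L.par v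

/-- The largest index in the block of the next layer that belongs to `v`. The `kids v` edges going
up from `v` are `p - 2` steps apart in the next layer, and the last of them is `p - 3` steps
before the first edge going up from the successor of `v`; so the block has `kids v * (p - 2) - 1`
elements. -/
def Layer.block (p q : ℕ) (L : Layer) (v : L.C) : ℕ := L.kids q v * (p - 2) - 2

/-- The layer that follows `L`. In its block `v`, the vertices whose index is a multiple of `p - 2`
are joined to `v`. For `p = 3` the vertex of index `0` is also joined to the predecessor of `v`. -/
def Layer.step (p q : ℕ) (L : Layer) : Layer where
  C := Blocks L.C (L.block p q)
  next := odometer L.next (L.block p q)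
  par x := if p - 2 ∣ x.1.2 then (if p = 3 ∧ x.1.2 = 0 then 2 else 1) else 0

/-- The vertices, other than the centre, of the `p`-gons at the centre: one block of `p - 2`
vertices for each of the `q` edges at the centre. -/
def firstLayer (p q : ℕ) : Layer where
  C := Blocks (ZMod q) fun _ => p - 3
  next := odometer (Equiv.addRight 1) fun _ => p - 3
  par x := if x.1.2 = 0 then 1 else 0

/-- The layers around the centre; the index is shifted, `layer p q n` has height `n + 1`. -/
def layer (p q : ℕ) : ℕ → Layer
  | 0 => firstLayer p q
  | n + 1 => (layer p q n).step p q

/-- The pairs `p, q` for which every block of the model is non-empty. -/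
def Admissible (p q : ℕ) : Prop := (4 ≤ p ∧ 4 ≤ q) ∨ (p = 3 ∧ 6 ≤ q)

section Layers

variable {p q : ℕ}

theorem Admissible.three_le (h : Admissible p q) : 3 ≤ p := by
  rcases h with h | h <;> omega

theorem Admissible.four_le (h : Admissible p q) : 4 ≤ q := by
  rcases h with h | h <;> omega

/-- The vertex of index `i` in the block of `v`. -/
def child {n : ℕ} (v : (layer p q n).C) (i : ℕ) (h : i ≤ (layer p q n).block p q v) :
    (layer p q (n + 1)).C := ⟨(v, i), h⟩

theorem exists_child {n : ℕ} (x : (layer p q (n + 1)).C) :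
    ∃ v i h, x = child (n := n) v i h :=
  ⟨x.1.1, x.1.2, x.2, rfl⟩

theorem child_congr {n : ℕ} {v v' : (layer p q n).C} {i i' : ℕ} {h h'} (hv : v = v') (hi : i = i') :
    child v i h = child v' i' h' := by
  subst hv hi; rfl

theorem child_inj {n : ℕ} {v v' : (layer p q n).C} {i i' : ℕ} {h h'} :
    child v i h = child v' i' h' ↔ v = v' ∧ i = i' := by
  exact Subtype.ext_iff.trans Prod.ext_iff

theorem par_child {n : ℕ} (v : (layer p q n).C) (i : ℕ) (h) :
    (layer p q (n + 1)).par (child v i h) =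
      if p - 2 ∣ i then (if p = 3 ∧ i = 0 then 2 else 1) else 0 := rfl

theorem next_child_of_lt {n : ℕ} {v : (layer p q n).C} {i : ℕ} (h)
    (hi : i < (layer p q n).block p q v) :
    (layer p q (n + 1)).next (child v i h) = child v (i + 1) hi :=
  odometer_of_lt _ _ _ hi

theorem next_child_last {n : ℕ} {v : (layer p q n).C} {i : ℕ} (h)
    (hi : i = (layer p q n).block p q v) :
    (layer p q (n + 1)).next (child v i h) = child ((layer p q n).next v) 0 (Nat.zero_le _) :=
  odometer_last _ _ _ hi

theorem next_iterate_child {n : ℕ} {v : (layer p q n).C} {i : ℕ} (j : ℕ) (h)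
    (hi : i + j ≤ (layer p q n).block p q v) :
    (layer p q (n + 1)).next^[j] (child v i h) = child v (i + j) hi :=
  odometer_iterate _ _ _ _ hi

/-- The vertex of index `i` in the block of the first layer that belongs to the edge `t` at the
centre. -/
def spoke (t : ZMod q) (i : ℕ) (h : i ≤ p - 3) : (layer p q 0).C := ⟨(t, i), h⟩

theorem exists_spoke (x : (layer p q 0).C) : ∃ t i h, x = spoke t i h :=
  ⟨x.1.1, x.1.2, x.2, rfl⟩

theorem spoke_congr {t t' : ZMod q} {i i' : ℕ} {h : i ≤ p - 3} {h'} (ht : t = t') (hi : i = i') :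
    spoke t i h = spoke t' i' h' := by
  subst ht hi; rfl

theorem spoke_inj {t t' : ZMod q} {i i' : ℕ} {h : i ≤ p - 3} {h'} :
    spoke t i h = spoke t' i' h' ↔ t = t' ∧ i = i' := by
  exact Subtype.ext_iff.trans Prod.ext_iff

theorem par_spoke (t : ZMod q) (i : ℕ) (h : i ≤ p - 3) :
    (layer p q 0).par (spoke t i h) = if i = 0 then 1 else 0 := rfl

theorem next_spoke_of_lt {t : ZMod q} {i : ℕ} (h) (hi : i < p - 3) :
    (layer p q 0).next (spoke t i h) = spoke t (i + 1) hi :=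
  odometer_of_lt (Equiv.addRight 1) (fun _ : ZMod q => p - 3) _ hi

theorem next_spoke_last {t : ZMod q} {i : ℕ} (h) (hi : i = p - 3) :
    (layer p q 0).next (spoke t i h) = spoke (t + 1) 0 (Nat.zero_le _) :=
  odometer_last (Equiv.addRight 1) (fun _ : ZMod q => p - 3) _ hi

theorem next_iterate_spoke {t : ZMod q} {i : ℕ} (j : ℕ) (h) (hi : i + j ≤ p - 3) :
    (layer p q 0).next^[j] (spoke t i h) = spoke t (i + j) hi :=
  odometer_iterate (Equiv.addRight 1) (fun _ : ZMod q => p - 3) _ _ hi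

theorem par_le_two (n : ℕ) (x : (layer p q n).C) : (layer p q n).par x ≤ 2 := by
  cases n with
  | zero => obtain ⟨t, i, h, rfl⟩ := exists_spoke x; rw [par_spoke]; split_ifs <;> omega
  | succ n => obtain ⟨v, i, h, rfl⟩ := exists_child x; rw [par_child]; split_ifs <;> omega

theorem par_le_one (hp : p ≠ 3) (n : ℕ) (x : (layer p q n).C) : (layer p q n).par x ≤ 1 := by
  cases n with
  | zero => obtain ⟨t, i, h, rfl⟩ := exists_spoke x; rw [par_spoke]; split_ifs <;> omega
  | succ n =>
    obtain ⟨v, i, h, rfl⟩ := exists_child x; rw [par_child]; split_ifs <;> omega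

theorem kids_add (hpq : Admissible p q) {n : ℕ} (x : (layer p q n).C) :
    (layer p q n).kids q x + (layer p q n).par x + 2 = q := by
  have h2 := par_le_two n x
  unfold Layer.kids
  have := hpq.four_le
  omega

theorem one_le_kids (hpq : Admissible p q) {n : ℕ} (x : (layer p q n).C) :
    1 ≤ (layer p q n).kids q x := by
  have h2 := par_le_two n x
  have h3 := kids_add hpq x
  rcases hpq with h | h
  · have := par_le_one (by omega) n x
    omega
  · omega

theorem two_le_kids (hpq : Admissible p q) (hp : p = 3) {n : ℕ} (x : (layer p q n).C) :
    2 ≤ (layer p q n).kids q x := by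
  have h2 := par_le_two n x
  have h3 := kids_add hpq x
  rcases hpq with h | h <;> omega

theorem block_add_two (hpq : Admissible p q) {n : ℕ} (x : (layer p q n).C) :
    (layer p q n).block p q x + 2 = (layer p q n).kids q x * (p - 2) := by
  unfold Layer.block
  have h1 := one_le_kids hpq x
  have : 2 ≤ (layer p q n).kids q x * (p - 2) := by
    by_cases hp : p = 3
    · have := two_le_kids hpq hp x
      subst hp; omega
    · have hp2 : 2 ≤ p - 2 := by have := hpq.three_le; omega
      nlinarith
  omega

/-- Every layer is run through by `next` until an edge to the previous layer is met. -/
theorem exists_par_pos (n : ℕ) (x : (layer p q n).C) :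
    ∃ j, 0 < (layer p q n).par ((layer p q n).next^[j + 1] x) := by
  cases n with
  | zero =>
    obtain ⟨j, hj⟩ := odometer_exists_iterate (Equiv.addRight 1) (fun _ : ZMod q => p - 3) x
    refine ⟨j, ?_⟩
    change 0 < (firstLayer p q).par ((odometer (Equiv.addRight 1) fun _ => p - 3)^[j + 1] x)
    rw [hj]; simp [firstLayer]
  | succ n =>
    obtain ⟨j, hj⟩ := odometer_exists_iterate (layer p q n).next ((layer p q n).block p q) x
    refine ⟨j, ?_⟩
    change 0 < ((layer p q n).step p q).par ((odometer _ _)^[j + 1] x)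
    rw [hj]; simp only [Layer.step, dvd_zero, if_true]; split_ifs <;> omega

theorem next_ne [NeZero q] (hq : 3 ≤ q) (n : ℕ) : (∀ x, (layer p q n).next x ≠ x) ∧
    ∀ x, (layer p q n).next ((layer p q n).next x) ≠ x := by
  induction n with
  | zero =>
    have h1 : ∀ v : ZMod q, Equiv.addRight 1 v ≠ v := by
      intro v h
      have : Fact (1 < q) := ⟨by omega⟩
      simp at h
    have h2 : ∀ v : ZMod q, Equiv.addRight 1 (Equiv.addRight 1 v) ≠ v := by
      intro v h
      have h3 : ((2 : ℕ) : ZMod q) = 0 := by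
        simp only [Equiv.coe_addRight, add_assoc, add_eq_left] at h
        push_cast
        rw [← h]; norm_num
      rw [ZMod.natCast_eq_zero_iff] at h3
      have := Nat.le_of_dvd (by norm_num) h3
      omega
    exact ⟨odometer_ne _ (fun _ => p - 3) h1, odometer_odometer_ne _ (fun _ => p - 3) h1 h2⟩
  | succ n ih => exact ⟨odometer_ne _ _ ih.1, odometer_odometer_ne _ _ ih.1 ih.2⟩

end Layers

end TilingModel

namespace TilingModel

/-! ### Darts of the model -/

/-- The vertices of the model: the centre and the vertices of the layers. -/
inductive Vertex (p q : ℕ) : Type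
  | center : Vertex p q
  | node (n : ℕ) (x : (layer p q n).C) : Vertex p q

open Vertex

/-- A dart is a vertex together with one of the `q` edge ends at it, numbered counterclockwise. At
a vertex `x` of a layer, number `0` is the edge to the predecessor of `x`, then come the edges to
the next layer, the edge to the successor of `x`, and the edges to the previous layer. -/
abbrev Dart (p q : ℕ) : Type := Vertex p q × ZMod q

section Darts

variable {p q : ℕ}

/-- The dart from `x` to its predecessor. -/
def predDart {n : ℕ} (x : (layer p q n).C) : Dart p q := (node n x, 0)

/-- The dart along the edge number `t` from `x` to the next layer. -/
def rungDart {n : ℕ} (x : (layer p q n).C) (t : ℕ) : Dart p q := (node n x, ((t + 1 : ℕ) : ZMod q))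

/-- The dart from `x` to its successor. -/
def succDart {n : ℕ} (x : (layer p q n).C) : Dart p q :=
  (node n x, (((layer p q n).kids q x + 1 : ℕ) : ZMod q))

/-- The dart along the edge number `j` from `x` to the previous layer. -/
def parDart {n : ℕ} (x : (layer p q n).C) (j : ℕ) : Dart p q :=
  (node n x, (((layer p q n).kids q x + 2 + j : ℕ) : ZMod q))

/-- The opposite of `rungDart v t`. The second alternative occurs only for `p = 3` and the last edge
of `v`, which ends at the first vertex of the block of the successor of `v`. -/
def upEnd {n : ℕ} (v : (layer p q n).C) (t : ℕ) : Dart p q :=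
  if h : t * (p - 2) ≤ (layer p q n).block p q v then parDart (child v (t * (p - 2)) h) 0
  else parDart (child ((layer p q n).next v) 0 (Nat.zero_le _)) 1

/-- The opposite of `parDart x j`. -/
def downEnd : (n : ℕ) → (layer p q n).C → ℕ → Dart p q
  | 0, x, _ => (center, x.1.1)
  | _ + 1, x, 0 => rungDart x.1.1 (x.1.2 / (p - 2))
  | n + 1, x, _ + 1 =>
    rungDart ((layer p q n).next.symm x.1.1)
      ((layer p q n).kids q ((layer p q n).next.symm x.1.1) - 1)

/-- The reversal of darts. -/
def flip : Dart p q → Dart p q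
  | (center, t) => parDart (spoke t 0 (Nat.zero_le _)) 0
  | (node n x, i) =>
    if i.val = 0 then succDart ((layer p q n).next.symm x)
    else if i.val ≤ (layer p q n).kids q x then upEnd x (i.val - 1)
    else if i.val = (layer p q n).kids q x + 1 then predDart ((layer p q n).next x)
    else downEnd n x (i.val - ((layer p q n).kids q x + 2))

/-- The counterclockwise rotation of darts around their vertex. -/
def rot : Equiv.Perm (Dart p q) := Equiv.prodCongr (Equiv.refl _) (Equiv.addRight 1)

theorem rot_apply (d : Dart p q) : rot d = (d.1, d.2 + 1) := rfl

theorem rot_symm_apply (d : Dart p q) : rot.symm d = (d.1, d.2 - 1) := by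
  simp [rot, sub_eq_add_neg, Prod.map]

theorem rot_pow (k : ℕ) (d : Dart p q) : (rot ^ k) d = (d.1, d.2 + k) := by
  induction k with
  | zero => simp
  | succ k ih => rw [pow_succ', Equiv.Perm.mul_apply, ih, rot_apply]; push_cast; simp [add_assoc]

theorem rot_pow_q : (rot : Equiv.Perm (Dart p q)) ^ q = 1 := by
  ext1 d
  rw [rot_pow]; simp

theorem rot_symm_rungDart_zero {n : ℕ} (x : (layer p q n).C) :
    rot.symm (rungDart x 0) = predDart x := by
  simp [rot_symm_apply, rungDart, predDart]

theorem rot_symm_rungDart_succ {n : ℕ} (x : (layer p q n).C) (t : ℕ) :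
    rot.symm (rungDart x (t + 1)) = rungDart x t := by
  simp [rot_symm_apply, rungDart]

theorem rot_symm_parDart_zero {n : ℕ} (x : (layer p q n).C) :
    rot.symm (parDart x 0) = succDart x := by
  simp only [rot_symm_apply, parDart, succDart]; push_cast; congr 1; ring

theorem rot_symm_parDart_succ {n : ℕ} (x : (layer p q n).C) (j : ℕ) :
    rot.symm (parDart x (j + 1)) = parDart x j := by
  simp only [rot_symm_apply, parDart]; push_cast; congr 1; ring

theorem rot_symm_succDart (hpq : Admissible p q) {n : ℕ} (x : (layer p q n).C) :
    rot.symm (succDart x) = rungDart x ((layer p q n).kids q x - 1) := by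
  have := one_le_kids hpq x
  simp only [rot_symm_apply, rungDart, succDart]
  rw [Nat.sub_add_cancel this]; push_cast; congr 1; ring

theorem rot_symm_predDart (hpq : Admissible p q) {n : ℕ} (x : (layer p q n).C)
    (hx : (layer p q n).par x = 0) : rot.symm (predDart x) = succDart x := by
  have := kids_add hpq x
  have h2 : (layer p q n).kids q x + 1 = q - 1 := by omega
  simp only [rot_symm_apply, predDart, succDart, h2]
  rw [Nat.cast_sub (by omega)]; simp

theorem rot_symm_predDart' (hpq : Admissible p q) {n : ℕ} (x : (layer p q n).C) (j : ℕ)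
    (hx : (layer p q n).par x = j + 1) : rot.symm (predDart x) = parDart x j := by
  have := kids_add hpq x
  have h2 : (layer p q n).kids q x + 2 + j = q - 1 := by omega
  simp only [rot_symm_apply, predDart, parDart, h2]
  rw [Nat.cast_sub (by omega)]; simp

/-- Every dart is of one of the five kinds. -/
theorem dart_cases (hpq : Admissible p q) {P : Dart p q → Prop}
    (h_center : ∀ t, P (center, t))
    (h_pred : ∀ n (x : (layer p q n).C), P (predDart x))
    (h_rung : ∀ n (x : (layer p q n).C) t, t < (layer p q n).kids q x → P (rungDart x t))
    (h_succ : ∀ n (x : (layer p q n).C), P (succDart x))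
    (h_par : ∀ n (x : (layer p q n).C) j, j < (layer p q n).par x → P (parDart x j)) (d) : P d := by
  have : NeZero q := ⟨by have := hpq.four_le; omega⟩
  obtain ⟨v, i⟩ := d
  cases v with
  | center => exact h_center i
  | node n x =>
    have h1 := kids_add hpq x
    have h2 := ZMod.val_lt i
    have h3 : i = ((i.val : ℕ) : ZMod q) := by simp
    rcases Nat.eq_zero_or_pos i.val with h0 | h0
    · have := h_pred n x
      unfold predDart at this
      rw [h3, h0]; simpa using this
    rcases le_or_gt i.val ((layer p q n).kids q x) with h4 | h4
    · have := h_rung n x (i.val - 1) (by omega)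
      unfold rungDart at this
      rwa [Nat.sub_add_cancel h0, ← h3] at this
    rcases eq_or_lt_of_le (Nat.succ_le_of_lt h4) with h5 | h5
    · have := h_succ n x
      unfold succDart at this
      rw [Nat.succ_eq_add_one] at h5
      rwa [h5, ← h3] at this
    · have := h_par n x (i.val - ((layer p q n).kids q x + 2)) (by omega)
      unfold parDart at this
      rwa [Nat.add_sub_cancel' h5, ← h3] at this

theorem flip_center (t : ZMod q) :
    flip (center, t) = parDart (p := p) (spoke t 0 (Nat.zero_le _)) 0 := rfl

theorem flip_predDart {n : ℕ} (x : (layer p q n).C) :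
    flip (predDart x) = succDart ((layer p q n).next.symm x) := by
  simp [flip, predDart]

theorem flip_rungDart (hpq : Admissible p q) {n : ℕ} (x : (layer p q n).C) (t : ℕ)
    (ht : t < (layer p q n).kids q x) : flip (rungDart x t) = upEnd x t := by
  have h1 := kids_add hpq x
  have h2 : ((t + 1 : ℕ) : ZMod q).val = t + 1 := ZMod.val_natCast_of_lt (by omega)
  simp only [flip, rungDart]
  rw [h2, if_neg (by omega), if_pos (by omega), Nat.add_sub_cancel]

theorem flip_succDart (hpq : Admissible p q) {n : ℕ} (x : (layer p q n).C) :
    flip (succDart x) = predDart ((layer p q n).next x) := by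
  have h1 := kids_add hpq x
  have h2 := ZMod.val_natCast_of_lt (n := q) (a := (layer p q n).kids q x + 1) (by omega)
  simp only [flip, succDart]
  rw [h2, if_neg (by omega), if_neg (by omega), if_pos rfl]

theorem flip_parDart (hpq : Admissible p q) {n : ℕ} (x : (layer p q n).C) (j : ℕ)
    (hj : j < (layer p q n).par x) : flip (parDart x j) = downEnd n x j := by
  have h1 := kids_add hpq x
  have h2 := ZMod.val_natCast_of_lt (n := q) (a := (layer p q n).kids q x + 2 + j) (by omega)
  simp only [flip, parDart]
  rw [h2, if_neg (by omega), if_neg (by omega), if_neg (by omega), Nat.add_sub_cancel_left]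

theorem flip_parDart_spoke (hpq : Admissible p q) (t : ZMod q) :
    flip (parDart (p := p) (spoke t 0 (Nat.zero_le _)) 0) = (center, t) := by
  rw [flip_parDart hpq]
  · rfl
  · rw [par_spoke]; simp

theorem flip_parDart_zero (hpq : Admissible p q) {n : ℕ} (v : (layer p q n).C) (t : ℕ)
    (h : t * (p - 2) ≤ (layer p q n).block p q v) :
    flip (parDart (child v (t * (p - 2)) h) 0) = rungDart v t := by
  have := hpq.three_le
  rw [flip_parDart hpq]
  · change rungDart v (t * (p - 2) / (p - 2)) = _
    rw [Nat.mul_div_cancel _ (by omega)]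
  · rw [par_child, if_pos (Dvd.intro_left t rfl)]; split_ifs <;> omega

theorem flip_parDart_one (hpq : Admissible p q) (hp : p = 3) {n : ℕ} (v : (layer p q n).C) :
    flip (parDart (child ((layer p q n).next v) 0 (Nat.zero_le _)) 1) =
      rungDart v ((layer p q n).kids q v - 1) := by
  rw [flip_parDart hpq]
  · change rungDart ((layer p q n).next.symm ((layer p q n).next v)) _ = _
    simp [child]
  · rw [par_child]; simp [hp]

theorem upEnd_of_le {n : ℕ} (v : (layer p q n).C) (t : ℕ)
    (h : t * (p - 2) ≤ (layer p q n).block p q v) :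
    upEnd v t = parDart (child v (t * (p - 2)) h) 0 := dif_pos h

theorem upEnd_last {n : ℕ} (v : (layer p q n).C) (t : ℕ)
    (h : ¬ t * (p - 2) ≤ (layer p q n).block p q v) :
    upEnd v t = parDart (child ((layer p q n).next v) 0 (Nat.zero_le _)) 1 := dif_neg h

/-- An edge to the next layer ends in the block of its own lower vertex, except for `p = 3`
and the last edge. -/
theorem mul_le_block (hpq : Admissible p q) {n : ℕ} {v : (layer p q n).C} {t : ℕ}
    (ht : t < (layer p q n).kids q v) (h : p ≠ 3 ∨ t + 1 < (layer p q n).kids q v) :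
    t * (p - 2) ≤ (layer p q n).block p q v := by
  have h1 := block_add_two hpq v
  have h2 := hpq.three_le
  by_cases hp : p = 3
  · subst hp
    simp only [Nat.reduceSub, mul_one] at h1 ⊢
    omega
  · have h3 : (t + 1) * (p - 2) ≤ (layer p q n).kids q v * (p - 2) := Nat.mul_le_mul_right _ ht
    rw [Nat.add_mul] at h3
    omega

theorem not_mul_le_block (hpq : Admissible p q) {n : ℕ} {v : (layer p q n).C} (hp : p = 3) :
    ¬ ((layer p q n).kids q v - 1) * (p - 2) ≤ (layer p q n).block p q v := by
  have h1 := block_add_two hpq v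
  subst hp
  simp only [Nat.reduceSub, mul_one] at h1 ⊢
  omega

theorem lt_kids_of_mul_le_block (hpq : Admissible p q) {n : ℕ} {v : (layer p q n).C} {t : ℕ}
    (h : t * (p - 2) ≤ (layer p q n).block p q v) : t < (layer p q n).kids q v := by
  have h1 := block_add_two hpq v
  by_contra hc
  have := Nat.mul_le_mul_right (p - 2) (not_lt.1 hc)
  omega

/-- The edges to the previous layer, case by case. -/
theorem par_cases {P : ∀ n, (layer p q n).C → ℕ → Prop}
    (h0 : ∀ t : ZMod q, P 0 (spoke t 0 (Nat.zero_le _)) 0)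
    (h1 : ∀ n (v : (layer p q n).C) (t : ℕ) (h : t * (p - 2) ≤ (layer p q n).block p q v),
      P (n + 1) (child v (t * (p - 2)) h) 0)
    (h2 : p = 3 → ∀ n (v : (layer p q n).C),
      P (n + 1) (child ((layer p q n).next v) 0 (Nat.zero_le _)) 1)
    (n) (x : (layer p q n).C) (j : ℕ) (hj : j < (layer p q n).par x) : P n x j := by
  cases n with
  | zero =>
    obtain ⟨t, i, h, rfl⟩ := exists_spoke x
    rw [par_spoke] at hj
    split_ifs at hj with hi
    · subst hi
      obtain rfl : j = 0 := by omega
      exact h0 t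
    · omega
  | succ n =>
    obtain ⟨v, i, h, rfl⟩ := exists_child x
    rw [par_child] at hj
    split_ifs at hj with hi hp
    · obtain ⟨hp, rfl⟩ := hp
      interval_cases j
      · have := h1 n v 0 (by simp)
        simpa using this
      · have := h2 hp n ((layer p q n).next.symm v)
        simpa using this
    · obtain ⟨t, rfl⟩ := hi
      obtain rfl : j = 0 := by omega
      have := h1 n v t (by rwa [mul_comm])
      rwa [child_congr rfl (mul_comm t (p - 2))] at this
    · omega

theorem flip_flip (hpq : Admissible p q) (d : Dart p q) : flip (flip d) = d := by
  refine dart_cases hpq (P := fun d => flip (flip d) = d) ?_ ?_ ?_ ?_ ?_ d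
  · intro t; rw [flip_center, flip_parDart_spoke hpq]
  · intro n x; rw [flip_predDart, flip_succDart hpq, Equiv.apply_symm_apply]
  · intro n x t ht
    rw [flip_rungDart hpq x t ht]
    by_cases h : t * (p - 2) ≤ (layer p q n).block p q x
    · rw [upEnd_of_le x t h, flip_parDart_zero hpq]
    · have h' : ¬ (p ≠ 3 ∨ t + 1 < (layer p q n).kids q x) := fun hc => h (mul_le_block hpq ht hc)
      push Not at h'
      rw [upEnd_last x t h, flip_parDart_one hpq h'.1]
      congr 1; omega
  · intro n x; rw [flip_succDart hpq, flip_predDart, Equiv.symm_apply_apply]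
  · refine par_cases (P := fun n x j => flip (flip (parDart x j)) = parDart x j) ?_ ?_ ?_
    · intro t; rw [flip_parDart_spoke hpq, flip_center]
    · intro n v t h
      rw [flip_parDart_zero hpq, flip_rungDart hpq _ _ (lt_kids_of_mul_le_block hpq h), upEnd_of_le]
    · intro hp n v
      have := one_le_kids hpq v
      rw [flip_parDart_one hpq hp, flip_rungDart hpq _ _ (by omega), upEnd_last]
      exact not_mul_le_block hpq hp

/-- The reversal of darts as a permutation. -/
def flipPerm (hpq : Admissible p q) : Equiv.Perm (Dart p q) :=
  ⟨flip, flip, flip_flip hpq, flip_flip hpq⟩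

theorem flipPerm_mul_self (hpq : Admissible p q) : flipPerm hpq * flipPerm hpq = 1 :=
  Equiv.ext (flip_flip hpq)

/-- The passage to the next dart around the face. -/
def face (hpq : Admissible p q) : Equiv.Perm (Dart p q) := rot⁻¹ * flipPerm hpq

theorem face_apply (hpq : Admissible p q) (d : Dart p q) : face hpq d = rot.symm (flip d) := rfl

theorem face_succDart_of_par_eq_zero (hpq : Admissible p q) {n : ℕ} (x : (layer p q n).C)
    (hx : (layer p q n).par ((layer p q n).next x) = 0) :
    face hpq (succDart x) = succDart ((layer p q n).next x) := by
  rw [face_apply, flip_succDart hpq, rot_symm_predDart hpq _ hx]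

theorem face_succDart_of_par_eq_succ (hpq : Admissible p q) {n : ℕ} (x : (layer p q n).C) {j : ℕ}
    (hx : (layer p q n).par ((layer p q n).next x) = j + 1) :
    face hpq (succDart x) = parDart ((layer p q n).next x) j := by
  rw [face_apply, flip_succDart hpq, rot_symm_predDart' hpq _ j hx]

/-- Vertices of a layer without edges to the previous layer are passed along the same face. -/
theorem face_pow_succDart (hpq : Admissible p q) {n : ℕ} (x : (layer p q n).C) (k : ℕ)
    (h : ∀ j, j < k → (layer p q n).par ((layer p q n).next^[j + 1] x) = 0) :
    (face hpq ^ k) (succDart x) = succDart ((layer p q n).next^[k] x) := by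
  induction k with
  | zero => rfl
  | succ k ih =>
    have h1 := h k (by omega)
    rw [Function.iterate_succ_apply'] at h1
    rw [pow_succ', Equiv.Perm.mul_apply, ih fun j hj => h j (by omega),
      face_succDart_of_par_eq_zero hpq _ h1, Function.iterate_succ_apply']

theorem face_predDart (hpq : Admissible p q) {n : ℕ} (x : (layer p q n).C) :
    face hpq (predDart x) = rungDart ((layer p q n).next.symm x)
      ((layer p q n).kids q ((layer p q n).next.symm x) - 1) := by
  rw [face_apply, flip_predDart, rot_symm_succDart hpq]

theorem face_predDart_next (hpq : Admissible p q) {n : ℕ} (x : (layer p q n).C) :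
    face hpq (predDart ((layer p q n).next x)) = rungDart x ((layer p q n).kids q x - 1) := by
  rw [face_predDart, Equiv.symm_apply_apply]

theorem face_rungDart (hpq : Admissible p q) {n : ℕ} (v : (layer p q n).C) (t : ℕ)
    (h : t * (p - 2) ≤ (layer p q n).block p q v) :
    face hpq (rungDart v t) = succDart (child v (t * (p - 2)) h) := by
  rw [face_apply, flip_rungDart hpq _ _ (lt_kids_of_mul_le_block hpq h), upEnd_of_le _ _ h,
    rot_symm_parDart_zero]

theorem face_rungDart_last (hpq : Admissible p q) (hp : p = 3) {n : ℕ} (v : (layer p q n).C) :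
    face hpq (rungDart v ((layer p q n).kids q v - 1)) =
      parDart (child ((layer p q n).next v) 0 (Nat.zero_le _)) 0 := by
  have := one_le_kids hpq v
  rw [face_apply, flip_rungDart hpq _ _ (by omega), upEnd_last _ _ (not_mul_le_block hpq hp),
    rot_symm_parDart_succ]

theorem face_parDart_zero (hpq : Admissible p q) {n : ℕ} (v : (layer p q n).C) (t : ℕ)
    (h : (t + 1) * (p - 2) ≤ (layer p q n).block p q v) :
    face hpq (parDart (child v ((t + 1) * (p - 2)) h) 0) = rungDart v t := by
  rw [face_apply, flip_parDart_zero hpq, rot_symm_rungDart_succ]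

theorem face_parDart_first (hpq : Admissible p q) {n : ℕ} (v : (layer p q n).C) :
    face hpq (parDart (child v 0 (Nat.zero_le _)) 0) = predDart v := by
  have := flip_parDart_zero hpq v 0 (by simp)
  rw [child_congr (h' := Nat.zero_le _) rfl (zero_mul _)] at this
  rw [face_apply, this, rot_symm_rungDart_zero]

theorem face_parDart_one (hpq : Admissible p q) (hp : p = 3) {n : ℕ} (v : (layer p q n).C) :
    face hpq (parDart (child ((layer p q n).next v) 0 (Nat.zero_le _)) 1) =
      rungDart v ((layer p q n).kids q v - 2) := by
  have := two_le_kids hpq hp v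
  rw [face_apply, flip_parDart_one hpq hp,
    show (layer p q n).kids q v - 1 = (layer p q n).kids q v - 2 + 1 by omega,
    rot_symm_rungDart_succ]

/-- The face between two edges from `v` to the next layer, or between the last edge from `v`
and the first edge from the successor of `v`, has `p` sides. -/
theorem face_pow_rungDart (hpq : Admissible p q) {n : ℕ} (v : (layer p q n).C) (t : ℕ)
    (ht : t < (layer p q n).kids q v) : (face hpq ^ p) (rungDart v t) = rungDart v t := by
  have hp3 := hpq.three_le
  have hb := block_add_two hpq v
  by_cases hp : p = 3
  · have hk := two_le_kids hpq hp v
    have h3 : ∀ d, (face hpq ^ p) d = face hpq (face hpq (face hpq d)) := by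
      intro d
      have e : face hpq ^ p = face hpq ^ 3 := congrArg (face hpq ^ ·) hp
      rw [e]; rfl
    rw [h3]
    have hb' : (layer p q n).block p q v + 2 = (layer p q n).kids q v := by
      rw [hb, show p - 2 = 1 by omega, mul_one]
    rcases lt_trichotomy (t + 2) ((layer p q n).kids q v) with h | h | h
    · rw [face_rungDart hpq _ _ (mul_le_block hpq ht (Or.inr (by omega)))]
      have e : (layer p q (n + 1)).next (child v (t * (p - 2))
          (mul_le_block hpq ht (Or.inr (by omega)))) = child v ((t + 1) * (p - 2))
          (mul_le_block hpq (by omega) (Or.inr (by omega))) := by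
        rw [next_child_of_lt _ (by subst hp; simp; omega)]
        exact child_congr rfl (by subst hp; simp)
      rw [face_succDart_of_par_eq_succ hpq (j := 0), e, face_parDart_zero hpq]
      rw [e, par_child, if_pos (Dvd.intro_left _ rfl), if_neg (by subst hp; simp)]
    · rw [face_rungDart hpq _ _ (mul_le_block hpq ht (Or.inr (by omega)))]
      have e : (layer p q (n + 1)).next (child v (t * (p - 2))
          (mul_le_block hpq ht (Or.inr (by omega)))) =
            child ((layer p q n).next v) 0 (Nat.zero_le _) :=
        next_child_last _ (by subst hp; simp; omega)
      rw [face_succDart_of_par_eq_succ hpq (j := 1), e, face_parDart_one hpq hp]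
      · congr 1; omega
      · rw [e, par_child]; simp [hp]
    · obtain rfl : t = (layer p q n).kids q v - 1 := by omega
      rw [face_rungDart_last hpq hp, face_parDart_first hpq, face_predDart_next hpq]
  · have hle := mul_le_block hpq ht (Or.inl hp)
    have hk : (t + 1) * (p - 2) ≤ (layer p q n).kids q v * (p - 2) := Nat.mul_le_mul_right _ ht
    have hnd : ∀ j, 0 < j → j < p - 2 → ¬ p - 2 ∣ t * (p - 2) + j := by
      intro j hj hj' hd
      have := (Nat.dvd_add_right (Dvd.intro_left t rfl)).1 hd
      exact absurd (Nat.le_of_dvd hj this) (by omega)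
    rw [Nat.add_mul] at hk
    rcases eq_or_lt_of_le (Nat.succ_le_of_lt ht) with h | h
    · have hlast : t * (p - 2) + (p - 4) = (layer p q n).block p q v := by
        rw [← h, Nat.succ_eq_add_one, Nat.add_mul] at hb; omega
      have hm : p = 1 + (1 + (1 + ((p - 4) + 1))) := by omega
      have e : face hpq ^ p =
          face hpq * (face hpq * (face hpq * (face hpq ^ (p - 4) * face hpq))) := by
        refine (congrArg (face hpq ^ ·) hm).trans ?_
        simp only [pow_add, pow_one]
      simp only [e, Equiv.Perm.mul_apply]
      rw [face_rungDart hpq _ _ hle, face_pow_succDart hpq _ (p - 4), next_iterate_child _ _ hlast.le,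
        face_succDart_of_par_eq_succ hpq (j := 0), next_child_last _ hlast, face_parDart_first,
        face_predDart_next hpq]
      · congr 1; omega
      · rw [next_child_last _ hlast, par_child]; simp [hp]
      · intro j hj
        rw [next_iterate_child _ _ (by omega), par_child, if_neg (hnd _ (by omega) (by omega))]
    · have hk' : (t + 2) * (p - 2) ≤ (layer p q n).kids q v * (p - 2) := Nat.mul_le_mul_right _ h
      rw [Nat.add_mul] at hk'
      have h2 : t * (p - 2) + (p - 3) < (layer p q n).block p q v := by omega
      have h1 : (t + 1) * (p - 2) ≤ (layer p q n).block p q v := mul_le_block hpq h (Or.inl hp)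
      have hm : p = 1 + (1 + ((p - 3) + 1)) := by omega
      have e : face hpq ^ p = face hpq * (face hpq * (face hpq ^ (p - 3) * face hpq)) := by
        refine (congrArg (face hpq ^ ·) hm).trans ?_
        simp only [pow_add, pow_one]
      have e2 : (layer p q (n + 1)).next (child v (t * (p - 2) + (p - 3)) h2.le) =
          child v ((t + 1) * (p - 2)) h1 := by
        rw [next_child_of_lt _ h2]
        exact child_congr rfl (by rw [Nat.add_mul]; omega)
      simp only [e, Equiv.Perm.mul_apply]
      rw [face_rungDart hpq _ _ hle, face_pow_succDart hpq _ (p - 3), next_iterate_child _ _ h2.le,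
        face_succDart_of_par_eq_succ hpq (j := 0), e2, face_parDart_zero hpq]
      · rw [e2, par_child, if_pos (Dvd.intro_left _ rfl), if_neg (by simp [hp])]
      · intro j hj
        rw [next_iterate_child _ _ (by omega), par_child, if_neg (hnd _ (by omega) (by omega))]

theorem face_pow_center (hpq : Admissible p q) (t : ZMod q) :
    (face hpq ^ p) (center, t) = (center, t) := by
  have hp3 := hpq.three_le
  have hm : p = 1 + (1 + ((p - 3) + 1)) := by omega
  have e : face hpq ^ p = face hpq * (face hpq * (face hpq ^ (p - 3) * face hpq)) := by
    refine (congrArg (face hpq ^ ·) hm).trans ?_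
    simp only [pow_add, pow_one]
  have e1 : face hpq (center, t) = succDart (spoke t 0 (Nat.zero_le _)) := by
    rw [face_apply, flip_center, rot_symm_parDart_zero]
  simp only [e, Equiv.Perm.mul_apply]
  rw [e1, face_pow_succDart hpq _ (p - 3), next_iterate_spoke _ _ (by omega),
    face_succDart_of_par_eq_succ hpq (j := 0), next_spoke_last _ (by omega), face_apply,
    flip_parDart_spoke hpq, rot_symm_apply]
  · simp
  · rw [next_spoke_last _ (by omega)]; rfl
  · intro j hj
    rw [next_iterate_spoke _ _ (by omega), par_spoke, if_neg (by omega)]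

/-- Every face of the model has `p` sides. -/
theorem face_pow (hpq : Admissible p q) : face hpq ^ p = 1 := by
  have key : ∀ d, (face hpq ^ p) (face hpq d) = face hpq d → (face hpq ^ p) d = d := by
    intro d h
    apply (face hpq).injective
    rw [← h, ← Equiv.Perm.mul_apply, ← Equiv.Perm.mul_apply, pow_mul_comm']
  have hpred : ∀ n (x : (layer p q n).C), (face hpq ^ p) (predDart x) = predDart x := by
    intro n x
    apply key
    have := one_le_kids hpq ((layer p q n).next.symm x)
    rw [face_predDart, face_pow_rungDart hpq _ _ (by omega)]
  have hpar : ∀ n (x : (layer p q n).C) j, j < (layer p q n).par x →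
      (face hpq ^ p) (parDart x j) = parDart x j := by
    refine par_cases (P := fun n x j => (face hpq ^ p) (parDart x j) = parDart x j) ?_ ?_ ?_
    · intro t
      apply key
      rw [face_apply, flip_parDart_spoke hpq, rot_symm_apply, face_pow_center hpq]
    · intro n v t h
      apply key
      cases t with
      | zero =>
        have e : child v (0 * (p - 2)) h = child v 0 (Nat.zero_le _) :=
          child_congr rfl (zero_mul _)
        rw [e, face_parDart_first hpq, hpred]
      | succ t =>
        have := lt_kids_of_mul_le_block hpq h
        rw [face_parDart_zero hpq, face_pow_rungDart hpq _ _ (by omega)]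
    · intro hp n v
      apply key
      have := two_le_kids hpq hp v
      rw [face_parDart_one hpq hp, face_pow_rungDart hpq _ _ (by omega)]
  have hsucc : ∀ n j (x : (layer p q n).C), 0 < (layer p q n).par ((layer p q n).next^[j + 1] x) →
      (face hpq ^ p) (succDart x) = succDart x := by
    intro n j
    induction j with
    | zero =>
      intro x hx
      obtain ⟨i, hi⟩ := Nat.exists_eq_add_of_lt hx
      rw [zero_add] at hi
      apply key
      rw [face_succDart_of_par_eq_succ hpq x hi, hpar]
      exact hi ▸ Nat.lt_succ_self _
    | succ j ih =>
      intro x hx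
      rcases Nat.eq_zero_or_pos ((layer p q n).par ((layer p q n).next x)) with h0 | h0
      · apply key
        rw [face_succDart_of_par_eq_zero hpq x h0, ih]
        rwa [Function.iterate_succ_apply] at hx
      · obtain ⟨i, hi⟩ := Nat.exists_eq_add_of_lt h0
        rw [zero_add] at hi
        apply key
        rw [face_succDart_of_par_eq_succ hpq x hi, hpar]
        exact hi ▸ Nat.lt_succ_self _
  ext1 d
  refine dart_cases hpq (P := fun d => (face hpq ^ p) d = d) (face_pow_center hpq) hpred
    (fun n x t ht => face_pow_rungDart hpq x t ht) (fun n x => ?_) hpar d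
  obtain ⟨j, hj⟩ := exists_par_pos n x
  exact hsucc n j x hj

end Darts

end TilingModel

namespace TilingModel

open Vertex

/-! ### Developing the model into a group -/

section Develop

variable {p q : ℕ} {Γ : Type*} [Group Γ]

/-- The element attached to the dart from `x` to its successor by the developing map that sends the
dart `(center, 0)` to `g₀`, the rotation to right multiplication by `a`, and the passage to the next
dart of a face to right multiplication by `z`. -/
def label (a z g₀ : Γ) : (n : ℕ) → (layer p q n).C → Γ
  | 0, x => g₀ * a ^ x.1.1.val * z ^ (x.1.2 + 1)
  | n + 1, x => label a z g₀ n x.1.1 *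
      a ^ (((x.1.2 / (p - 2) : ℕ) : ℤ) - ((layer p q n).kids q x.1.1 : ℤ)) *
      z ^ (x.1.2 % (p - 2) + 1)

/-- The developing map on darts. -/
def develop (a z g₀ : Γ) : Dart p q → Γ
  | (center, t) => g₀ * a ^ t.val
  | (node n x, i) => label a z g₀ n x * a ^ ((i.val : ℤ) - ((layer p q n).kids q x : ℤ) - 1)

variable {a z : Γ} (g₀ : Γ)

theorem label_spoke (t : ZMod q) (i : ℕ) (h : i ≤ p - 3) :
    label a z g₀ 0 (spoke t i h) = g₀ * a ^ t.val * z ^ (i + 1) := rfl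

theorem label_child (hpq : Admissible p q) {n : ℕ} (v : (layer p q n).C) (t r : ℕ) (hr : r < p - 2)
    (i : ℕ) (hi : i = t * (p - 2) + r) (h : i ≤ (layer p q n).block p q v) :
    label a z g₀ (n + 1) (child v i h) =
      label a z g₀ n v * a ^ ((t : ℤ) - ((layer p q n).kids q v : ℤ)) * z ^ (r + 1) := by
  have := hpq.three_le
  have h1 : i / (p - 2) = t := by
    rw [hi, mul_comm, Nat.mul_add_div (by omega), Nat.div_eq_of_lt hr, add_zero]
  have h2 : i % (p - 2) = r := by
    rw [hi, mul_comm, Nat.mul_add_mod, Nat.mod_eq_of_lt hr]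
  change label a z g₀ n v * a ^ (((i / (p - 2) : ℕ) : ℤ) - _) * z ^ (i % (p - 2) + 1) = _
  rw [h1, h2]
  rfl

theorem pow_zmod_val_add_one [NeZero q] (ha : a ^ q = 1) (t : ZMod q) :
    a ^ (t + 1).val = a ^ t.val * a := by
  rw [← pow_succ, ZMod.val_add, ZMod.val_one_eq_one_mod, Nat.add_mod_mod, ← pow_eq_pow_mod _ ha]

theorem pow_zmod_val_natCast (ha : a ^ q = 1) (m : ℕ) : a ^ (m : ZMod q).val = a ^ m := by
  rw [ZMod.val_natCast, ← pow_eq_pow_mod _ ha]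

/-- The elements attached to the darts of a layer fit together along the layer. -/
theorem label_next (hpq : Admissible p q) (ha : a ^ q = 1) (hz : z ^ p = 1)
    (haz : z * a * (z * a) = 1) (n : ℕ) (x : (layer p q n).C) :
    label a z g₀ n ((layer p q n).next x) * a ^ (layer p q n).par ((layer p q n).next x) =
      label a z g₀ n x * z := by
  have hp3 := hpq.three_le
  have hq : NeZero q := ⟨by have := hpq.four_le; omega⟩
  have e1 : a * z * a = z⁻¹ := by
    rw [eq_comm, inv_eq_iff_mul_eq_one, ← haz]; group
  have e2 : z * a = a⁻¹ * z⁻¹ := by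
    rw [← mul_inv_rev, eq_inv_iff_mul_eq_one]; exact haz
  have e3 : z ^ (p - 1) = z⁻¹ := by
    rw [eq_inv_iff_mul_eq_one, ← pow_succ, Nat.sub_add_cancel (by omega), hz]
  have e4 : z ^ (p - 2) = z⁻¹ * z⁻¹ := by
    rw [eq_mul_inv_iff_mul_eq, ← pow_succ, show p - 2 + 1 = p - 1 by omega, e3]
  cases n with
  | zero =>
    obtain ⟨t, i, h, rfl⟩ := exists_spoke x
    rcases Nat.lt_or_ge i (p - 3) with hi | hi
    · rw [next_spoke_of_lt h hi, label_spoke, label_spoke, par_spoke, if_neg (by omega), pow_zero,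
        mul_one, pow_succ _ (i + 1)]
      simp only [mul_assoc]
    · rw [next_spoke_last h (by omega), label_spoke, label_spoke, par_spoke, if_pos rfl, pow_one,
        pow_zmod_val_add_one ha, pow_one, mul_assoc _ (z ^ (i + 1)) z, ← pow_succ z (i + 1),
        show i + 1 + 1 = p - 1 by omega, e3, ← e1]
      simp only [mul_assoc]
  | succ n =>
    obtain ⟨v, i, h, rfl⟩ := exists_child x
    have hb := block_add_two hpq v
    have hmod : i % (p - 2) < p - 2 := Nat.mod_lt _ (by omega)
    have hdiv : i = i / (p - 2) * (p - 2) + i % (p - 2) := by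
      rw [mul_comm]; exact (Nat.div_add_mod _ _).symm
    rw [label_child g₀ hpq v (i / (p - 2)) (i % (p - 2)) hmod i hdiv]
    rcases lt_or_eq_of_le h with hi | hi
    · rw [next_child_of_lt h hi]
      rcases Nat.lt_or_ge (i % (p - 2) + 1) (p - 2) with hr | hr
      · have hnd : ¬ p - 2 ∣ i + 1 := by
          intro hd
          have : p - 2 ∣ i % (p - 2) + 1 := by
            rw [hdiv, add_assoc] at hd
            exact (Nat.dvd_add_right (Dvd.intro_left _ rfl)).1 hd
          exact absurd (Nat.le_of_dvd (by omega) this) (by omega)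
        rw [label_child g₀ hpq v (i / (p - 2)) (i % (p - 2) + 1) hr (i + 1) (by omega), par_child,
          if_neg hnd, pow_zero, mul_one, pow_succ _ (_ + 1)]
        simp only [mul_assoc]
      · have hi1 : i + 1 = (i / (p - 2) + 1) * (p - 2) + 0 := by
          rw [Nat.add_mul]; omega
        rw [label_child g₀ hpq v (i / (p - 2) + 1) 0 (by omega) (i + 1) hi1, par_child,
          if_pos ⟨i / (p - 2) + 1, by rw [hi1, add_zero, mul_comm]⟩, if_neg (by omega), pow_one,
          pow_one, mul_assoc _ (z ^ (i % (p - 2) + 1)) z, ← pow_succ,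
          show i % (p - 2) + 1 + 1 = p - 1 by omega,
          e3, ← e1, Nat.cast_add, Nat.cast_one, add_sub_right_comm, zpow_add_one]
        simp only [mul_assoc]
    · rw [next_child_last h hi]
      have ih := label_next hpq ha hz haz n v
      have hk' := kids_add hpq ((layer p q n).next v)
      have e5 : label a z g₀ n ((layer p q n).next v) *
          a ^ (((0 : ℕ) : ℤ) - ((layer p q n).kids q ((layer p q n).next v) : ℤ)) =
            label a z g₀ n v * z * a * a := by
        rw [← ih, Nat.cast_zero, zero_sub, mul_assoc, mul_assoc]
        congr 1
        rw [← pow_two, ← pow_add, zpow_neg, inv_eq_iff_mul_eq_one, zpow_natCast,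
          ← pow_add, ← add_assoc]
        exact (congrArg (a ^ ·) hk').trans ha
      rw [label_child g₀ hpq ((layer p q n).next v) 0 0 (by omega) 0 (by simp), par_child, e5]
      by_cases hp : p = 3
      · have hk : (layer p q n).block p q v + 2 = (layer p q n).kids q v := by
          rw [hb, show p - 2 = 1 by omega, mul_one]
        have hz3 : z⁻¹ * z⁻¹ = z := by
          rw [← e4, show p - 2 = 1 by omega, pow_one]
        rw [if_pos (dvd_zero _), if_pos ⟨hp, rfl⟩, zero_add, pow_one]
        have e6 : ((i / (p - 2) : ℕ) : ℤ) - ((layer p q n).kids q v : ℤ) = -1 - 1 := by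
          rw [← hk, show p - 2 = 1 by omega, Nat.div_one, hi]; push_cast; ring
        rw [e6, zpow_sub_one, zpow_neg_one, show i % (p - 2) = 0 by
          rw [show p - 2 = 1 by omega, Nat.mod_one], zero_add, pow_one, pow_two]
        calc label a z g₀ n v * z * a * a * z * (a * a)
            = label a z g₀ n v * (z * a * (a * z * a) * a) := by simp only [mul_assoc]
          _ = label a z g₀ n v * (a⁻¹ * (z⁻¹ * z⁻¹) * a) := by rw [e1, e2]; simp only [mul_assoc]
          _ = label a z g₀ n v * (a⁻¹ * (a⁻¹ * z⁻¹)) := by rw [hz3, mul_assoc, e2]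
          _ = label a z g₀ n v * (a⁻¹ * a⁻¹) * z * z := by
              have : z⁻¹ = z * z := by
                rw [← e3, hp, pow_two]
              rw [this]; simp only [mul_assoc]
      · have hr : i % (p - 2) = p - 4 ∧ i / (p - 2) + 1 = (layer p q n).kids q v := by
          have hk1 := one_le_kids hpq v
          obtain ⟨k, hk⟩ := Nat.exists_eq_add_of_le' hk1
          rw [hk, Nat.add_mul] at hb
          have : i = (p - 2) * k + (p - 4) := by rw [mul_comm]; omega
          rw [this, Nat.mul_add_mod, Nat.mul_add_div (by omega), Nat.mod_eq_of_lt (by omega),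
            Nat.div_eq_of_lt (by omega)]
          omega
        rw [if_pos (dvd_zero _), if_neg (by tauto), pow_one, pow_one, hr.1, ← hr.2,
          mul_assoc _ (z ^ (p - 4 + 1)) z, ← pow_succ, show p - 4 + 1 + 1 = p - 2 by omega, e4]
        have e6 : ((i / (p - 2) : ℕ) : ℤ) - ((i / (p - 2) + 1 : ℕ) : ℤ) = -1 := by
          push_cast; ring
        rw [e6, zpow_neg_one]
        calc label a z g₀ n v * z * a * a * z * a
            = label a z g₀ n v * (z * a * (a * z * a)) := by simp only [mul_assoc]
          _ = _ := by rw [e1, e2]; simp only [mul_assoc]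

theorem develop_node (ha : a ^ q = 1) {n : ℕ} (x : (layer p q n).C) (m : ℕ) :
    develop a z g₀ (node n x, (m : ZMod q)) =
      label a z g₀ n x * a ^ ((m : ℤ) - ((layer p q n).kids q x : ℤ) - 1) := by
  simp only [develop]
  rw [sub_sub, zpow_sub, zpow_natCast, pow_zmod_val_natCast ha, ← zpow_natCast, ← zpow_sub, sub_sub]

theorem develop_rungDart (ha : a ^ q = 1) {n : ℕ} (x : (layer p q n).C) (t : ℕ) :
    develop a z g₀ (rungDart x t) =
      label a z g₀ n x * a ^ ((t : ℤ) - ((layer p q n).kids q x : ℤ)) := by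
  rw [rungDart, develop_node g₀ ha]; congr 2; push_cast; ring

theorem develop_succDart (ha : a ^ q = 1) {n : ℕ} (x : (layer p q n).C) :
    develop a z g₀ (succDart x) = label a z g₀ n x := by
  rw [succDart, develop_node g₀ ha]
  simp

theorem develop_parDart (ha : a ^ q = 1) {n : ℕ} (x : (layer p q n).C) (j : ℕ) :
    develop a z g₀ (parDart x j) = label a z g₀ n x * a ^ (j + 1) := by
  rw [parDart, develop_node g₀ ha, ← zpow_natCast]; congr 2; push_cast; ring

theorem develop_rot [NeZero q] (ha : a ^ q = 1) (d : Dart p q) :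
    develop a z g₀ (rot d) = develop a z g₀ d * a := by
  obtain ⟨v, i⟩ := d
  rw [rot_apply]
  cases v with
  | center => simp only [develop]; rw [pow_zmod_val_add_one ha, mul_assoc]
  | node n x =>
    have : i + 1 = ((i.val + 1 : ℕ) : ZMod q) := by push_cast; simp
    simp only
    rw [this, develop_node g₀ ha]
    simp only [develop]
    rw [mul_assoc, ← zpow_add_one]; congr 2; push_cast; ring

theorem develop_predDart_next (hpq : Admissible p q) (ha : a ^ q = 1) (hz : z ^ p = 1)
    (haz : z * a * (z * a) = 1) {n : ℕ} (x : (layer p q n).C) :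
    develop a z g₀ (predDart ((layer p q n).next x)) = label a z g₀ n x * (z * a) := by
  have h := label_next g₀ hpq ha hz haz n x
  have hk := kids_add hpq ((layer p q n).next x)
  rw [← mul_assoc, ← h, predDart, show (0 : ZMod q) = ((0 : ℕ) : ZMod q) by simp,
    develop_node g₀ ha, mul_assoc]
  congr 1
  rw [Nat.cast_zero, zero_sub, ← neg_add', ← Nat.cast_succ, zpow_neg, zpow_natCast,
    inv_eq_iff_mul_eq_one, ← pow_succ, ← pow_add, ← ha]
  congr 1; omega

/-- The developing map sends the reversal of darts to right multiplication by `z * a`. -/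
theorem develop_flip (hpq : Admissible p q) (ha : a ^ q = 1) (hz : z ^ p = 1)
    (haz : z * a * (z * a) = 1) (d : Dart p q) :
    develop a z g₀ (flip d) = develop a z g₀ d * (z * a) := by
  have hp3 := hpq.three_le
  have e1 : a * z * a = z⁻¹ := by
    rw [eq_comm, inv_eq_iff_mul_eq_one, ← haz]; group
  have e2 : z * a = a⁻¹ * z⁻¹ := by
    rw [← mul_inv_rev, eq_inv_iff_mul_eq_one]; exact haz
  have key : ∀ d : Dart p q, develop a z g₀ (flip d) = develop a z g₀ d * (z * a) →
      develop a z g₀ (flip (flip d)) = develop a z g₀ (flip d) * (z * a) := by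
    intro d h
    rw [flip_flip hpq, h, mul_assoc, haz, mul_one]
  have hrung : ∀ n (v : (layer p q n).C) (t : ℕ), t < (layer p q n).kids q v →
      develop a z g₀ (flip (rungDart v t)) = develop a z g₀ (rungDart v t) * (z * a) := by
    intro n v t ht
    rw [flip_rungDart hpq _ _ ht, develop_rungDart g₀ ha]
    by_cases h : t * (p - 2) ≤ (layer p q n).block p q v
    · rw [upEnd_of_le _ _ h, develop_parDart g₀ ha,
        label_child g₀ hpq v t 0 (by omega) _ (by simp)]
      simp [mul_assoc]
    · have h' : ¬ (p ≠ 3 ∨ t + 1 < (layer p q n).kids q v) := fun hc => h (mul_le_block hpq ht hc)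
      push Not at h'
      have hz3 : z⁻¹ * z⁻¹ = z := by
        rw [← mul_inv_rev, inv_eq_iff_mul_eq_one, ← hz, h'.1, pow_succ, pow_two]
      have h0 : label a z g₀ (n + 1) (child ((layer p q n).next v) 0 (Nat.zero_le _)) =
          develop a z g₀ (rungDart ((layer p q n).next v) 0) * z := by
        rw [label_child g₀ hpq _ 0 0 (by omega) _ (by simp), develop_rungDart g₀ ha]; simp
      have h1 : develop a z g₀ (rungDart ((layer p q n).next v) 0) =
          label a z g₀ n v * (z * a) * a := by
        rw [← develop_predDart_next g₀ hpq ha hz haz, ← rot_symm_rungDart_zero]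
        have : NeZero q := ⟨by have := hpq.four_le; omega⟩
        rw [← develop_rot g₀ ha, Equiv.apply_symm_apply]
      rw [upEnd_last _ _ h, develop_parDart g₀ ha, h0, h1]
      have e6 : (t : ℤ) - ((layer p q n).kids q v : ℤ) = -1 := by omega
      rw [e6, zpow_neg_one]
      calc label a z g₀ n v * (z * a) * a * z * a ^ (1 + 1)
          = label a z g₀ n v * (z * a * (a * z * a) * a) := by
            rw [pow_two]; simp only [mul_assoc]
        _ = label a z g₀ n v * (a⁻¹ * (z⁻¹ * z⁻¹) * a) := by rw [e1, e2]; simp only [mul_assoc]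
        _ = label a z g₀ n v * a⁻¹ * (z * a) := by rw [hz3]; simp only [mul_assoc]
  have hsucc : ∀ n (x : (layer p q n).C),
      develop a z g₀ (flip (succDart x)) = develop a z g₀ (succDart x) * (z * a) := by
    intro n x
    rw [flip_succDart hpq, develop_succDart g₀ ha, develop_predDart_next g₀ hpq ha hz haz]
  have hcenter : ∀ t : ZMod q, develop a z g₀ (flip (center, t) : Dart p q) =
      develop a z g₀ ((center, t) : Dart p q) * (z * a) := by
    intro t
    rw [flip_center, develop_parDart g₀ ha, label_spoke]
    simp [develop, mul_assoc]
  refine dart_cases hpq (P := fun d => develop a z g₀ (flip d) = develop a z g₀ d * (z * a))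
    hcenter (fun n x => ?_) hrung hsucc ?_ d
  · have := key _ (hsucc n ((layer p q n).next.symm x))
    rwa [flip_succDart hpq, Equiv.apply_symm_apply] at this
  · refine par_cases (P := fun n x j => develop a z g₀ (flip (parDart x j)) =
      develop a z g₀ (parDart x j) * (z * a)) (fun t => ?_) (fun n v t h => ?_) (fun hp n v => ?_)
    · have := key _ (hcenter t)
      rwa [flip_center] at this
    · have hk := lt_kids_of_mul_le_block hpq h
      have := key _ (hrung n v t hk)
      rwa [flip_rungDart hpq _ _ hk, upEnd_of_le _ _ h] at this
    · have hk := one_le_kids hpq v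
      have := key _ (hrung n v ((layer p q n).kids q v - 1) (by omega))
      rwa [flip_rungDart hpq _ _ (by omega), upEnd_last _ _ (not_mul_le_block hpq hp)] at this

end Develop

end TilingModel

namespace TilingModel

open Vertex

/-! ### The tessellation and its model -/

section Graph

variable {p q : ℕ}

/-- The graph of the model: two vertices are adjacent if a dart at one of them has its opposite at
the other. -/
def modelGraph (hpq : Admissible p q) : SimpleGraph (Vertex p q) where
  Adj x y := x ≠ y ∧ ∃ i, (flip (x, i)).1 = y
  symm := ⟨by
    rintro x y ⟨h, i, hi⟩
    refine ⟨h.symm, (flip (x, i)).2, ?_⟩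
    subst hi
    rw [Prod.mk.eta, flip_flip hpq]⟩
  loopless := ⟨fun x h => h.1 rfl⟩

theorem modelGraph_adj (hpq : Admissible p q) {x y : Vertex p q} :
    (modelGraph hpq).Adj x y ↔ x ≠ y ∧ ∃ i, (flip (x, i)).1 = y := Iff.rfl

end Graph

section Action

variable {p q : ℕ}

/-- The action of the three reflections on flags. A flag is a dart together with a side of it;
the vertex of the flag is the one of the dart. -/
def flagPerm (hpq : Admissible p q) : Fin 3 → Equiv.Perm (Dart p q × Bool)
  | 0 => ⟨fun x => (flip x.1, !x.2), fun x => (flip x.1, !x.2),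
      fun x => by simp [flip_flip hpq], fun x => by simp [flip_flip hpq]⟩
  | 1 => ⟨fun x => (if x.2 then rot.symm x.1 else rot x.1, !x.2),
      fun x => (if x.2 then rot.symm x.1 else rot x.1, !x.2),
      by rintro ⟨d, _ | _⟩ <;> simp, by rintro ⟨d, _ | _⟩ <;> simp⟩
  | 2 => ⟨fun x => (x.1, !x.2), fun x => (x.1, !x.2), fun x => by simp, fun x => by simp⟩

theorem flagPerm_zero (hpq : Admissible p q) (x : Dart p q × Bool) :
    flagPerm hpq 0 x = (flip x.1, !x.2) := rfl

theorem flagPerm_one_false (hpq : Admissible p q) (d : Dart p q) :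
    flagPerm hpq 1 (d, false) = (rot d, true) := rfl

theorem flagPerm_one_true (hpq : Admissible p q) (d : Dart p q) :
    flagPerm hpq 1 (d, true) = (rot.symm d, false) := rfl

theorem flagPerm_two (hpq : Admissible p q) (x : Dart p q × Bool) :
    flagPerm hpq 2 x = (x.1, !x.2) := rfl

theorem flagPerm_mul_self (hpq : Admissible p q) (i : Fin 3) :
    flagPerm hpq i * flagPerm hpq i = 1 := by
  ext1 x
  obtain ⟨d, e⟩ := x
  fin_cases i <;> cases e <;>
    simp [flagPerm_zero, flagPerm_one_false, flagPerm_one_true, flagPerm_two, flip_flip hpq]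

/-- A permutation of flags that acts as `A` on one side and as `B` on the other has the order of
these permutations. -/
theorem pow_eq_one_of_sides {D : Type*} {T : Equiv.Perm (D × Bool)} {A B : Equiv.Perm D} {k : ℕ}
    (hA : ∀ d, T (d, false) = (A d, false)) (hB : ∀ d, T (d, true) = (B d, true))
    (hAk : A ^ k = 1) (hBk : B ^ k = 1) : T ^ k = 1 := by
  have h1 : ∀ m d, (T ^ m) (d, false) = ((A ^ m) d, false) := by
    intro m d
    induction m with
    | zero => rfl
    | succ m ih => rw [pow_succ', Equiv.Perm.mul_apply, ih, hA, pow_succ' A, Equiv.Perm.mul_apply]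
  have h2 : ∀ m d, (T ^ m) (d, true) = ((B ^ m) d, true) := by
    intro m d
    induction m with
    | zero => rfl
    | succ m ih => rw [pow_succ', Equiv.Perm.mul_apply, ih, hB, pow_succ' B, Equiv.Perm.mul_apply]
  ext1 ⟨d, e⟩
  cases e
  · rw [h1, hAk]; rfl
  · rw [h2, hBk]; rfl

theorem pow_mul_comm_eq_one {Γ : Type*} [Group Γ] {x y : Γ} {k : ℕ} (hx : x * x = 1)
    (hy : y * y = 1) (h : (x * y) ^ k = 1) : (y * x) ^ k = 1 := by
  have : y * x = (x * y)⁻¹ := by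
    rw [mul_inv_rev, inv_eq_of_mul_eq_one_right hx, inv_eq_of_mul_eq_one_right hy]
  rw [this, inv_pow, h, inv_one]

theorem flagPerm_zero_one (hpq : Admissible p q) : (flagPerm hpq 0 * flagPerm hpq 1) ^ p = 1 := by
  have hf : (rot⁻¹ * flipPerm hpq) ^ p = 1 := face_pow hpq
  have hff := flipPerm_mul_self hpq
  have hi : (flipPerm hpq)⁻¹ = flipPerm hpq := inv_eq_of_mul_eq_one_right hff
  refine pow_eq_one_of_sides (A := flipPerm hpq * rot) (B := flipPerm hpq * rot⁻¹) ?_ ?_ ?_ ?_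
  · intro d
    rw [Equiv.Perm.mul_apply, flagPerm_one_false, flagPerm_zero]; rfl
  · intro d
    rw [Equiv.Perm.mul_apply, flagPerm_one_true, flagPerm_zero]; rfl
  · have : flipPerm hpq * rot = (rot⁻¹ * flipPerm hpq)⁻¹ := by
      rw [mul_inv_rev, inv_inv, hi]
    rw [this, inv_pow, hf, inv_one]
  · have : flipPerm hpq * rot⁻¹ =
        flipPerm hpq * (rot⁻¹ * flipPerm hpq) * (flipPerm hpq)⁻¹ := by
      rw [mul_assoc, mul_assoc, mul_inv_cancel, mul_one]
    rw [this, conj_pow, hf, mul_one, mul_inv_cancel]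

theorem flagPerm_one_two (hpq : Admissible p q) : (flagPerm hpq 1 * flagPerm hpq 2) ^ q = 1 := by
  refine pow_eq_one_of_sides (A := rot⁻¹) (B := rot) ?_ ?_ ?_ rot_pow_q
  · intro d
    rw [Equiv.Perm.mul_apply, flagPerm_two]; rfl
  · intro d
    rw [Equiv.Perm.mul_apply, flagPerm_two]; rfl
  · rw [inv_pow, rot_pow_q, inv_one]

theorem flagPerm_zero_two (hpq : Admissible p q) : (flagPerm hpq 0 * flagPerm hpq 2) ^ 2 = 1 := by
  have : (flipPerm hpq) ^ 2 = 1 := by rw [pow_two, flipPerm_mul_self]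
  refine pow_eq_one_of_sides (A := flipPerm hpq) (B := flipPerm hpq) ?_ ?_ this this
  · intro d
    rw [Equiv.Perm.mul_apply, flagPerm_two, flagPerm_zero]; rfl
  · intro d
    rw [Equiv.Perm.mul_apply, flagPerm_two, flagPerm_zero]; rfl

variable (hp : 3 ≤ p) (hq : 3 ≤ q)

theorem isLiftable_flagPerm (hpq : Admissible p q) :
    (tilingCoxeterMatrix p q hp hq).IsLiftable (flagPerm hpq) := by
  have h := flagPerm_mul_self hpq
  intro i j
  fin_cases i <;> fin_cases j
  · exact (pow_one _).trans (h 0)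
  · exact flagPerm_zero_one hpq
  · exact flagPerm_zero_two hpq
  · exact pow_mul_comm_eq_one (h 0) (h 1) (flagPerm_zero_one hpq)
  · exact (pow_one _).trans (h 1)
  · exact flagPerm_one_two hpq
  · exact pow_mul_comm_eq_one (h 0) (h 2) (flagPerm_zero_two hpq)
  · exact pow_mul_comm_eq_one (h 1) (h 2) (flagPerm_one_two hpq)
  · exact (pow_one _).trans (h 2)

/-- The action of the symmetry group of the tessellation on the flags of the model. -/
def flagAction (hpq : Admissible p q) : TilingGroup p q hp hq →* Equiv.Perm (Dart p q × Bool) :=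
  (tilingCoxeterMatrix p q hp hq).toCoxeterSystem.lift ⟨_, isLiftable_flagPerm hp hq hpq⟩

theorem flagAction_reflection (hpq : Admissible p q) (i : Fin 3) :
    flagAction hp hq hpq (tilingReflection p q hp hq i) = flagPerm hpq i := by
  have := (tilingCoxeterMatrix p q hp hq).toCoxeterSystem.lift_apply_simple
    (isLiftable_flagPerm hp hq hpq) i
  rwa [CoxeterMatrix.toCoxeterSystem_simple] at this

theorem tilingReflection_mul_self (i : Fin 3) :
    tilingReflection p q hp hq i * tilingReflection p q hp hq i = 1 := by
  have := (tilingCoxeterMatrix p q hp hq).toCoxeterSystem.simple_mul_simple_self i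
  rwa [CoxeterMatrix.toCoxeterSystem_simple] at this

theorem tilingReflection_mul_pow (i j : Fin 3) :
    (tilingReflection p q hp hq i * tilingReflection p q hp hq j) ^
      (tilingCoxeterMatrix p q hp hq) i j = 1 := by
  have := (tilingCoxeterMatrix p q hp hq).toCoxeterSystem.simple_mul_simple_pow i j
  rwa [CoxeterMatrix.toCoxeterSystem_simple] at this

theorem tilingGroup_induction {P : TilingGroup p q hp hq → Prop} (one : P 1)
    (mul : ∀ w i, P w → P (w * tilingReflection p q hp hq i)) (w) : P w := by
  refine (tilingCoxeterMatrix p q hp hq).toCoxeterSystem.simple_induction_right w one ?_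
  intro w i h
  have := mul w i h
  rwa [CoxeterMatrix.toCoxeterSystem_simple]

/-- Every dart can be reached from the centre by rotations and reversals. -/
theorem dart_induction (hpq : Admissible p q) {P : Dart p q → Prop} (h0 : P (center, 0))
    (hrot : ∀ d, P d → P (rot d)) (hflip : ∀ d, P d → P (flip d)) (d) : P d := by
  have hp3 := hpq.three_le
  have hq0 : NeZero q := ⟨by have := hpq.four_le; omega⟩
  have hvert : ∀ (x : Vertex p q) i, P (x, i) → ∀ j, P (x, j) := by
    intro x i h j
    have h1 : ∀ k : ℕ, P (x, i + k) := by
      intro k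
      induction k with
      | zero => simpa using h
      | succ k ih =>
        have := hrot _ ih
        rw [rot_apply] at this
        push_cast; rwa [← add_assoc]
    have := h1 (j - i).val
    simpa using this
  have hnext : ∀ n (x : (layer p q n).C), (∀ j, P (node n x, j)) →
      ∀ j, P (node n ((layer p q n).next x), j) := by
    intro n x h
    have := hflip _ (h ((((layer p q n).kids q x + 1 : ℕ) : ZMod q)))
    change P (flip (succDart x)) at this
    rw [flip_succDart hpq] at this
    exact hvert _ _ this
  have hnode : ∀ n (x : (layer p q n).C) j, P (node n x, j) := by
    intro n
    induction n with
    | zero =>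
      intro x
      obtain ⟨t, i, h, rfl⟩ := exists_spoke x
      induction i with
      | zero =>
        have := hflip _ (hvert _ _ h0 t)
        rw [flip_center] at this
        exact hvert _ _ this
      | succ i ih =>
        have := hnext _ _ (ih (by omega))
        rwa [next_spoke_of_lt _ (by omega)] at this
    | succ n ihn =>
      intro x
      obtain ⟨v, i, h, rfl⟩ := exists_child x
      induction i with
      | zero =>
        have h1 := hflip _ (ihn v ((0 + 1 : ℕ) : ZMod q))
        change P (flip (rungDart v 0)) at h1
        have h2 := one_le_kids hpq v
        rw [flip_rungDart hpq _ _ (by omega), upEnd_of_le _ _ (by simp)] at h1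
        have e : child v (0 * (p - 2)) (by simp) = child v 0 h := child_congr rfl (zero_mul _)
        rw [e] at h1
        exact hvert _ _ h1
      | succ i ih =>
        have := hnext _ _ (ih (by omega))
        rwa [next_child_of_lt _ (by omega)] at this
  obtain ⟨v, i⟩ := d
  cases v with
  | center => exact hvert _ _ h0 i
  | node n x => exact hnode n x i

/-- The graph of the tessellation is isomorphic to the graph of the model, and any vertex may be
placed at the centre. -/
theorem exists_iso (hpq : Admissible p q) (o : TilingVertex p q hp hq) :
    ∃ e : tilingGraph p q hp hq ≃g modelGraph hpq, e o = center := by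
  have hq0 : NeZero q := ⟨by omega⟩
  obtain ⟨g₀, rfl⟩ := QuotientGroup.mk_surjective o
  obtain ⟨r, hr⟩ : ∃ r, r = tilingReflection p q hp hq := ⟨_, rfl⟩
  have hsq : ∀ i, r i * r i = 1 := by rw [hr]; exact tilingReflection_mul_self hp hq
  have ha : (r 1 * r 2) ^ q = 1 := by rw [hr]; exact tilingReflection_mul_pow hp hq 1 2
  have hz : (r 0 * r 1) ^ p = 1 := by rw [hr]; exact tilingReflection_mul_pow hp hq 0 1
  have hc : (r 0 * r 2) ^ 2 = 1 := by rw [hr]; exact tilingReflection_mul_pow hp hq 0 2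
  have hza : r 0 * r 1 * (r 1 * r 2) = r 0 * r 2 := by
    rw [mul_assoc, ← mul_assoc (r 1), hsq, one_mul]
  have haz : r 0 * r 1 * (r 1 * r 2) * (r 0 * r 1 * (r 1 * r 2)) = 1 := by
    rw [hza, ← pow_two, hc]
  have hcomm : r 0 * r 2 = r 2 * r 0 := by
    rw [eq_inv_of_mul_eq_one_left (by rw [← pow_two, hc] : r 0 * r 2 * (r 0 * r 2) = 1),
      mul_inv_rev, inv_eq_of_mul_eq_one_right (hsq 0), inv_eq_of_mul_eq_one_right (hsq 2)]
  -- `F` sends a group element to a flag, `S` is the developing map on flags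
  let F : TilingGroup p q hp hq → Dart p q × Bool := fun h =>
    flagAction hp hq hpq (h⁻¹ * g₀) ((center, 0), false)
  let s : Dart p q → TilingGroup p q hp hq := develop (r 1 * r 2) (r 0 * r 1) g₀
  let S : Dart p q × Bool → TilingGroup p q hp hq := fun x => if x.2 then s x.1 * r 2 else s x.1
  have hF0 : F g₀ = ((center, 0), false) := by simp [F]
  have hF : ∀ h i, F (h * r i) = flagPerm hpq i (F h) := by
    intro h i
    simp only [F]
    rw [mul_inv_rev, mul_assoc, map_mul, Equiv.Perm.mul_apply,
      inv_eq_of_mul_eq_one_right (hsq i), hr, flagAction_reflection]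
  have hs0 : s (center, 0) = g₀ := by simp [s, develop]
  have hsrot : ∀ d, s (rot d) = s d * (r 1 * r 2) := develop_rot g₀ ha
  have hsflip : ∀ d, s (flip d) = s d * (r 0 * r 2) := by
    intro d
    rw [← hza]
    exact develop_flip g₀ hpq ha hz haz d
  have hS : ∀ i x, S (flagPerm hpq i x) = S x * r i := by
    rintro i ⟨d, e⟩
    fin_cases i
    · cases e
      · simp [flagPerm_zero, S, hsflip, mul_assoc, hsq]
      · simp [flagPerm_zero, S, hsflip, mul_assoc, hcomm]
    · cases e
      · simp [flagPerm_one_false, S, hsrot, mul_assoc, hsq]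
      · have := hsrot (rot.symm d)
        rw [Equiv.apply_symm_apply] at this
        simp [flagPerm_one_true, S, this, mul_assoc, hsq]
    · cases e <;> simp [flagPerm_two, S, mul_assoc, hsq]
  have hSF : ∀ h, S (F h) = h := by
    have : ∀ w, S (F (g₀ * w)) = g₀ * w := by
      intro w
      refine tilingGroup_induction hp hq (P := fun w => S (F (g₀ * w)) = g₀ * w) ?_ ?_ w
      · simp [hF0, S, hs0]
      · intro w i h
        rw [← hr, ← mul_assoc, hF, hS, h]
    intro h
    simpa using this (g₀⁻¹ * h)
  have hFs : ∀ d, F (s d) = (d, false) := by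
    refine dart_induction hpq ?_ ?_ ?_
    · rw [hs0, hF0]
    · intro d h
      rw [hsrot, ← mul_assoc, hF, hF, h, flagPerm_one_false, flagPerm_two]; rfl
    · intro d h
      rw [hsflip, ← mul_assoc, hF, hF, h, flagPerm_zero, flagPerm_two]; rfl
  set W : Subgroup (TilingGroup p q hp hq) := Subgroup.closure {r 1, r 2} with hW
  have hW1 : r 1 ∈ W := Subgroup.subset_closure (by simp)
  have hW2 : r 2 ∈ W := Subgroup.subset_closure (by simp)
  have hvert : ∀ w ∈ W, ∀ h, (F (h * w)).1.1 = (F h).1.1 := by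
    intro w hw
    induction hw using Subgroup.closure_induction with
    | mem x hx =>
      intro h
      rcases hx with rfl | rfl
      · rw [hF]
        generalize F h = y
        obtain ⟨d, e⟩ := y
        cases e <;> rfl
      · rw [hF]; rfl
    | one => intro h; rw [mul_one]
    | mul x y _ _ hx hy => intro h; rw [← mul_assoc, hy, hx]
    | inv x _ hx => intro h; rw [← hx (h * x⁻¹), inv_mul_cancel_right]
  have hrotpow : ∀ (x : Vertex p q) (k : ℕ), s (x, k) = s (x, 0) * (r 1 * r 2) ^ k := by
    intro x k
    induction k with
    | zero => simp
    | succ k ih =>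
      have := hsrot (x, k)
      rw [rot_apply] at this
      push_cast
      rw [this, ih, pow_succ, mul_assoc]
  have hcoset : ∀ x : Dart p q × Bool, (s (x.1.1, 0))⁻¹ * S x ∈ W := by
    rintro ⟨⟨v, i⟩, e⟩
    have h1 : s (v, i) = s (v, 0) * (r 1 * r 2) ^ i.val := by
      rw [← hrotpow]; simp
    have h2 : (r 1 * r 2) ^ i.val ∈ W := W.pow_mem (W.mul_mem hW1 hW2) _
    cases e
    · simpa [S, h1] using h2
    · simpa [S, h1, mul_assoc] using W.mul_mem h2 hW2
  subst hr
  let e : TilingVertex p q hp hq ≃ Vertex p q :=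
    { toFun := Quotient.lift (fun h => (F h).1.1) (by
        intro h h' hh
        have := hvert _ (QuotientGroup.leftRel_apply.1 hh) h
        rw [mul_inv_cancel_left] at this
        exact this.symm)
      invFun := fun x => QuotientGroup.mk (s (x, 0))
      left_inv := by
        intro v
        obtain ⟨h, rfl⟩ := QuotientGroup.mk_surjective v
        change (QuotientGroup.mk (s ((F h).1.1, 0)) : TilingVertex p q hp hq) = QuotientGroup.mk h
        rw [QuotientGroup.eq]
        have := hcoset (F h)
        rwa [hSF] at this
      right_inv := by
        intro x
        change (F (s (x, 0))).1.1 = x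
        rw [hFs] }
  have he : ∀ h, e (QuotientGroup.mk h) = (F h).1.1 := fun h => rfl
  have hdir : ∀ g, e (QuotientGroup.mk (g * tilingReflection p q hp hq 0)) =
      (flip ((F g).1.1, (F g).1.2)).1 := by
    intro g
    rw [he, hF]; rfl
  refine ⟨⟨e, ?_⟩, ?_⟩
  · intro v w
    rw [modelGraph_adj, tilingGraph, SimpleGraph.fromRel_adj, e.injective.ne_iff]
    refine and_congr_right fun hvw => ⟨?_, ?_⟩
    · rintro ⟨i, hi⟩
      left
      refine ⟨s (e v, i), e.injective ?_, e.injective ?_⟩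
      · rw [he, hFs]
      · rw [hdir, hFs, ← hi]
    · rintro (⟨g, rfl, rfl⟩ | ⟨g, rfl, rfl⟩)
      · exact ⟨(F g).1.2, (hdir g).symm⟩
      · have : (modelGraph hpq).Adj (e (QuotientGroup.mk g))
            (e (QuotientGroup.mk (g * tilingReflection p q hp hq 0))) :=
          ⟨e.injective.ne hvw.symm, (F g).1.2, (hdir g).symm⟩
        exact this.symm.2
  · change (F g₀).1.1 = center
    rw [hF0]

end Action

end TilingModel

namespace SimpleGraph

/-! ### Cycles as cyclic sequences -/

section CyclicSequences

variable {V : Type*} {G : SimpleGraph V}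

theorem exists_walk_of_seq (f : ℕ → V) (n : ℕ) (h : ∀ i < n, G.Adj (f i) (f (i + 1))) :
    ∃ w : G.Walk (f 0) (f n), w.length = n ∧ ∀ i ≤ n, w.getVert i = f i := by
  induction n generalizing f with
  | zero => exact ⟨Walk.nil, rfl, fun i hi => by obtain rfl : i = 0 := by omega
                                                 rfl⟩
  | succ n ih =>
    obtain ⟨w, hw, hf⟩ := ih (fun i => f (i + 1)) fun i hi => h (i + 1) (by omega)
    refine ⟨Walk.cons (h 0 (by omega)) w, by simp [hw], ?_⟩
    intro i hi
    cases i with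
    | zero => simp
    | succ i => rw [Walk.getVert_cons_succ, hf i (by omega)]

/-- Two vertices lie on a common cycle of length `p` if and only if they are members of an injective
cyclic sequence of `p` vertices. -/
theorem exists_isCycle_iff_seq {p : ℕ} (hp : 3 ≤ p) {v v' : V} :
    (∃ (u : V) (c : G.Walk u u), c.IsCycle ∧ c.length = p ∧ v ∈ c.support ∧ v' ∈ c.support) ↔
      ∃ f : ℕ → V, f 0 = v' ∧ f p = v' ∧ (∃ m < p, f m = v) ∧ (∀ i < p, G.Adj (f i) (f (i + 1))) ∧
        Set.InjOn f (Set.Iio p) := by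
  classical
  constructor
  · rintro ⟨u, c, hc, hl, hv, hv'⟩
    have hc' := (Walk.isCycle_rotate hv').2 hc
    have hl' : (c.rotate v' hv').length = p := by rw [Walk.length_rotate, hl]
    have hv2 : v ∈ (c.rotate v' hv').support := (Walk.mem_support_rotate_iff ..).2 hv
    generalize c.rotate v' hv' = d at hc' hl' hv2
    refine ⟨d.getVert, d.getVert_zero, by rw [← hl', d.getVert_length], ?_,
      fun i hi => d.adj_getVert_succ (by omega), ?_⟩
    · obtain ⟨m, hm, hml⟩ := Walk.mem_support_iff_exists_getVert.1 hv2
      rcases eq_or_lt_of_le hml with h | h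
      · refine ⟨0, by omega, ?_⟩
        rw [← hm, h, d.getVert_length, d.getVert_zero]
      · exact ⟨m, by omega, hm⟩
    · intro i hi j hj hij
      simp only [Set.mem_Iio] at hi hj
      exact hc'.getVert_injOn' (by simp only [Set.mem_ofPred_eq]; omega)
        (by simp only [Set.mem_ofPred_eq]; omega) hij
  · rintro ⟨f, h0, hfp, ⟨m, hm, hfm⟩, hadj, hinj⟩
    obtain ⟨w, hw, hf⟩ := exists_walk_of_seq f p hadj
    refine ⟨f 0, w.copy rfl (hfp.trans h0.symm), ?_, by simp [hw], ?_, ?_⟩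
    · rw [Walk.isCycle_iff_isPath_tail_and_le_length]
      refine ⟨?_, by simpa [hw] using hp⟩
      rw [← Walk.IsPath.getVert_injOn_iff]
      have hlen : (w.copy rfl (hfp.trans h0.symm)).tail.length + 1 = p := by
        rw [Walk.length_tail_add_one, Walk.length_copy, hw]
        intro h
        have := Walk.length_eq_zero_iff.2 h
        rw [Walk.length_copy] at this
        omega
      have hval : ∀ i, i + 1 ≤ p →
          (w.copy rfl (hfp.trans h0.symm)).tail.getVert i = f (if i + 1 = p then 0 else i + 1) := by
        intro i hi
        rw [Walk.getVert_tail, Walk.getVert_copy, hf _ hi]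
        split_ifs with h
        · rw [h, hfp, h0]
        · rfl
      intro i hi j hj hij
      simp only [Set.mem_ofPred_eq] at hi hj
      rw [hval i (by omega), hval j (by omega)] at hij
      have := hinj (by simp only [Set.mem_Iio]; split_ifs <;> omega)
        (by simp only [Set.mem_Iio]; split_ifs <;> omega) hij
      split_ifs at this <;> omega
    · rw [Walk.support_copy, ← hfm, ← hf m hm.le]; exact w.getVert_mem_support m
    · rw [Walk.support_copy, ← h0]; exact w.start_mem_support

end CyclicSequences

/-! ### Layers of a locally finite graph -/

section Layers

variable {V : Type*} (G : SimpleGraph V) (p : ℕ) (o : V)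

theorem layerBall_subset_succ (n : ℕ) : G.layerBall p o n ⊆ G.layerBall p o (n + 1) :=
  fun _ h => Or.inl (Or.inl h)

theorem mem_layerSubgraph_edgeSet {n : ℕ} {v w : V} : s(v, w) ∈ (G.layerSubgraph p o n).edgeSet ↔
    v ∈ G.layerBall p o n ∧ w ∈ G.layerBall p o n ∧ G.Adj v w := by
  simp [layerSubgraph]

theorem layerSubgraph_edgeSet_subset_succ (n : ℕ) :
    (G.layerSubgraph p o n).edgeSet ⊆ (G.layerSubgraph p o (n + 1)).edgeSet := by
  intro e
  induction e with
  | h v w =>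
    simp only [mem_layerSubgraph_edgeSet]
    exact fun h => ⟨layerBall_subset_succ G p o n h.1, layerBall_subset_succ G p o n h.2.1, h.2.2⟩

/-- In a locally finite graph the vertices at bounded distance from a finite set form a finite
set. -/
theorem finite_walk_le (hG : ∀ v, {w | G.Adj v w}.Finite) {A : Set V} (hA : A.Finite) (k : ℕ) :
    {v | ∃ v' ∈ A, ∃ w : G.Walk v' v, w.length = k}.Finite := by
  induction k with
  | zero =>
    refine hA.subset ?_
    rintro v ⟨v', hv', w, hw⟩
    rwa [← Walk.eq_of_length_eq_zero hw]
  | succ k ih =>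
    refine (ih.biUnion fun v _ => hG v).subset ?_
    rintro v ⟨v', hv', w, hw⟩
    refine Set.mem_biUnion (x := w.getVert k) ⟨v', hv', w.take k, ?_⟩ ?_
    · rw [Walk.take_length, hw]; simp
    · have := w.adj_getVert_succ (i := k) (by omega)
      rw [← hw, w.getVert_length] at this
      exact this

theorem finite_edgeNeighbors (hG : ∀ v, {w | G.Adj v w}.Finite) {A : Set V} (hA : A.Finite) :
    (G.edgeNeighbors A).Finite := by
  refine (hA.biUnion fun v _ => hG v).subset ?_
  rintro v ⟨_, v', hv', h⟩
  exact Set.mem_biUnion hv' h.symm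

theorem finite_cycleNeighbors (hG : ∀ v, {w | G.Adj v w}.Finite) {A : Set V} (hA : A.Finite)
    (hp : 3 ≤ p) : (G.cycleNeighbors p A).Finite := by
  refine ((Set.finite_Iio p).biUnion fun k _ => finite_walk_le G hG hA k).subset ?_
  rintro v ⟨_, v', hv', h⟩
  obtain ⟨f, h0, hfp, ⟨m, hm, hfm⟩, hadj, -⟩ := (exists_isCycle_iff_seq hp).1 h
  obtain ⟨w, hw, -⟩ := exists_walk_of_seq f m fun i hi => hadj i (by omega)
  refine Set.mem_biUnion (x := m) hm ⟨v', hv', w.copy h0 hfm, by simp [hw]⟩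

theorem finite_layerBall (hG : ∀ v, {w | G.Adj v w}.Finite) (hp : 3 ≤ p) (n : ℕ) :
    (G.layerBall p o n).Finite := by
  induction n with
  | zero => exact Set.finite_singleton o
  | succ n ih =>
    exact (ih.union (finite_edgeNeighbors G hG ih)).union (finite_cycleNeighbors G p hG ih hp)

theorem finite_layerSubgraph_edgeSet {n : ℕ} (h : (G.layerBall p o n).Finite) :
    (G.layerSubgraph p o n).edgeSet.Finite := by
  refine ((h.prod h).image fun x => s(x.1, x.2)).subset ?_
  intro e
  induction e with
  | h v w =>
    rw [mem_layerSubgraph_edgeSet]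
    exact fun h => ⟨(v, w), ⟨h.1, h.2.1⟩, rfl⟩

theorem ncard_layerBall (h : ∀ n, (G.layerBall p o n).Finite) (n : ℕ) :
    (G.layerBall p o n).ncard = ∑ k ∈ Finset.range (n + 1), G.s p o k := by
  induction n with
  | zero => simp [s, layerVerts]
  | succ n ih =>
    rw [Finset.sum_range_succ, ← ih,
      ← Set.ncard_sdiff_add_ncard_of_subset (layerBall_subset_succ G p o n) (h _)]
    exact add_comm _ _

theorem ncard_layerSubgraph_edgeSet (h : ∀ n, (G.layerBall p o n).Finite) (n : ℕ) :
    (G.layerSubgraph p o n).edgeSet.ncard = ∑ k ∈ Finset.Icc 1 n, G.b p o k := by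
  induction n with
  | zero =>
    have : (G.layerSubgraph p o 0).edgeSet = ∅ := by
      ext e
      induction e with
      | h v w =>
        rw [mem_layerSubgraph_edgeSet]
        simp only [layerBall, Set.mem_singleton_iff, Set.mem_empty_iff_false, iff_false]
        rintro ⟨rfl, rfl, h⟩
        exact h.ne rfl
    simp [this]
  | succ n ih =>
    rw [Finset.sum_Icc_succ_top (by omega), ← ih,
      ← Set.ncard_sdiff_add_ncard_of_subset (layerSubgraph_edgeSet_subset_succ G p o n)
        (finite_layerSubgraph_edgeSet G p o (h _))]
    exact add_comm _ _

end Layers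

/-! ### Layers and isomorphisms -/

section Iso

variable {V W : Type*} {G : SimpleGraph V} {H : SimpleGraph W} (e : G ≃g H) (p : ℕ) (o : V)

theorem Iso.image_edgeNeighbors (A : Set V) : e '' G.edgeNeighbors A = H.edgeNeighbors (e '' A) := by
  ext w
  obtain ⟨v, rfl⟩ := e.surjective w
  rw [e.injective.mem_set_image]
  simp only [edgeNeighbors, Set.mem_ofPred_eq, e.injective.mem_set_image, Set.exists_mem_image,
    Iso.map_adj_iff]

theorem Iso.image_cycleNeighbors (A : Set V) :
    e '' G.cycleNeighbors p A = H.cycleNeighbors p (e '' A) := by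
  ext w
  obtain ⟨v, rfl⟩ := e.surjective w
  rw [e.injective.mem_set_image]
  simp only [cycleNeighbors, Set.mem_ofPred_eq, ← Iso.image_edgeNeighbors, ← Set.image_union,
    e.injective.mem_set_image, Set.exists_mem_image]
  refine and_congr_right fun _ => exists_congr fun v' => and_congr_right fun _ => ⟨?_, ?_⟩
  · rintro ⟨u, c, hc, hl, h1, h2⟩
    refine ⟨e u, c.map e.toHom, hc.map e.injective, by simpa using hl, ?_, ?_⟩
    · rw [Walk.support_map]; exact List.mem_map_of_mem h1
    · rw [Walk.support_map]; exact List.mem_map_of_mem h2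
  · rintro ⟨u, c, hc, hl, h1, h2⟩
    refine ⟨e.symm u, c.map e.symm.toHom, hc.map e.symm.injective, by simpa using hl, ?_, ?_⟩
    · rw [Walk.support_map]
      simpa using List.mem_map_of_mem (f := e.symm) h1
    · rw [Walk.support_map]
      simpa using List.mem_map_of_mem (f := e.symm) h2

theorem Iso.image_layerBall (n : ℕ) : e '' G.layerBall p o n = H.layerBall p (e o) n := by
  induction n with
  | zero => simp [layerBall]
  | succ n ih =>
    simp only [layerBall, Set.image_union, Iso.image_edgeNeighbors, Iso.image_cycleNeighbors, ih]

theorem Iso.s₁_eq (n : ℕ) : H.s₁ p (e o) n = G.s₁ p o n := by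
  have : H.layerFirst p (e o) n = e '' G.layerFirst p o n := by
    cases n with
    | zero => simp [layerFirst]
    | succ n => simp only [layerFirst, Iso.image_edgeNeighbors, Iso.image_layerBall]
  rw [SimpleGraph.s₁, this, Set.ncard_image_of_injective _ e.injective]; rfl

theorem Iso.s₂_eq (n : ℕ) : H.s₂ p (e o) n = G.s₂ p o n := by
  have : H.layerSecond p (e o) n = e '' G.layerSecond p o n := by
    cases n with
    | zero => simp [layerSecond]
    | succ n => simp only [layerSecond, Iso.image_cycleNeighbors, Iso.image_layerBall]
  rw [SimpleGraph.s₂, this, Set.ncard_image_of_injective _ e.injective]; rfl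

theorem Iso.s_eq (n : ℕ) : H.s p (e o) n = G.s p o n := by
  have : H.layerVerts p (e o) n = e '' G.layerVerts p o n := by
    cases n with
    | zero => simp only [layerVerts, Iso.image_layerBall]
    | succ n => simp only [layerVerts, Iso.image_layerBall, Set.image_sdiff e.injective]
  rw [SimpleGraph.s, this, Set.ncard_image_of_injective _ e.injective]; rfl

theorem Iso.image_layerSubgraph_edgeSet (n : ℕ) :
    Sym2.map e '' (G.layerSubgraph p o n).edgeSet = (H.layerSubgraph p (e o) n).edgeSet := by
  ext x
  induction x with
  | h w w' =>
    obtain ⟨v, rfl⟩ := e.surjective w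
    obtain ⟨v', rfl⟩ := e.surjective w'
    rw [← Sym2.map_mk, (Sym2.map.injective e.injective).mem_set_image, Sym2.map_mk,
      mem_layerSubgraph_edgeSet, mem_layerSubgraph_edgeSet, ← Iso.image_layerBall,
      e.injective.mem_set_image, e.injective.mem_set_image, Iso.map_adj_iff]

theorem Iso.b_eq (n : ℕ) : H.b p (e o) n = G.b p o n := by
  have : H.layerEdges p (e o) n = Sym2.map e '' G.layerEdges p o n := by
    cases n with
    | zero => simp only [layerEdges, Iso.image_layerSubgraph_edgeSet]
    | succ n => simp only [layerEdges, Iso.image_layerSubgraph_edgeSet,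
        Set.image_sdiff (Sym2.map.injective e.injective)]
  rw [SimpleGraph.b, this, Set.ncard_image_of_injective _ (Sym2.map.injective e.injective)]; rfl

end Iso

end SimpleGraph

namespace TilingModel

/-! ### The tessellation is locally finite -/

section LocallyFinite

theorem finite_closure_pair {Γ : Type*} [Group Γ] {x y : Γ} {k : ℕ} (hk : 0 < k) (hx : x * x = 1)
    (hy : y * y = 1) (hxy : (x * y) ^ k = 1) : (Subgroup.closure {x, y} : Set Γ).Finite := by
  have hfin : (Subgroup.zpowers (x * y) : Set Γ).Finite := by
    have : IsOfFinOrder (x * y) := isOfFinOrder_iff_pow_eq_one.2 ⟨k, hk, hxy⟩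
    exact (finite_zpowers.2 this)
  have hxi : x⁻¹ = x := inv_eq_of_mul_eq_one_right hx
  have hyi : y⁻¹ = y := inv_eq_of_mul_eq_one_right hy
  refine (hfin.union (hfin.image (· * x))).subset ?_
  have hmulx : ∀ g, g ∈ Subgroup.zpowers (x * y) ∨ g * x ∈ Subgroup.zpowers (x * y) →
      g * x ∈ Subgroup.zpowers (x * y) ∨ g * x * x ∈ Subgroup.zpowers (x * y) := by
    rintro g (h | h)
    · right; rwa [mul_assoc, hx, mul_one]
    · left; exact h
  have hmuly : ∀ g, g ∈ Subgroup.zpowers (x * y) ∨ g * x ∈ Subgroup.zpowers (x * y) →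
      g * y ∈ Subgroup.zpowers (x * y) ∨ g * y * x ∈ Subgroup.zpowers (x * y) := by
    have h1 := Subgroup.mem_zpowers (x * y)
    rintro g (h | h)
    · right
      have := mul_mem h (inv_mem h1)
      rwa [mul_inv_rev, hxi, hyi, ← mul_assoc] at this
    · left
      have := mul_mem h h1
      rwa [mul_assoc, ← mul_assoc x, hx, one_mul] at this
  intro g hg
  have key : g ∈ Subgroup.zpowers (x * y) ∨ g * x ∈ Subgroup.zpowers (x * y) := by
    induction hg using Subgroup.closure_induction_right with
    | one => left; exact one_mem _
    | mul_right g h _ hh ih =>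
      rcases hh with rfl | rfl
      · exact hmulx _ ih
      · exact hmuly _ ih
    | mul_inv_cancel g h _ hh ih =>
      rcases hh with rfl | rfl
      · rw [hxi]; exact hmulx _ ih
      · rw [hyi]; exact hmuly _ ih
  rcases key with h | h
  · left; exact h
  · right; exact ⟨g * x, h, by simp only [mul_assoc, hx, mul_one]⟩

theorem finite_tilingGraph_adj {p q : ℕ} (hp : 3 ≤ p) (hq : 3 ≤ q) (v : TilingVertex p q hp hq) :
    {w | (tilingGraph p q hp hq).Adj v w}.Finite := by
  have h12 := tilingReflection_mul_pow hp hq 1 2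
  have hfin := finite_closure_pair (k := q) (by omega) (tilingReflection_mul_self hp hq 1)
    (tilingReflection_mul_self hp hq 2) h12
  obtain ⟨h, rfl⟩ := QuotientGroup.mk_surjective v
  refine (hfin.image fun w => (QuotientGroup.mk (h * w * tilingReflection p q hp hq 0) :
    TilingVertex p q hp hq)).subset ?_
  intro w hw
  rw [Set.mem_ofPred_eq, tilingGraph, SimpleGraph.fromRel_adj] at hw
  obtain ⟨-, ⟨g, h1, h2⟩ | ⟨g, h1, h2⟩⟩ := hw
  · refine ⟨h⁻¹ * g, QuotientGroup.eq.1 h1, ?_⟩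
    simp only [mul_inv_cancel_left]; exact h2.symm
  · refine ⟨h⁻¹ * (g * tilingReflection p q hp hq 0), QuotientGroup.eq.1 h2, ?_⟩
    simp only [mul_inv_cancel_left]
    rw [mul_assoc, tilingReflection_mul_self, mul_one]; exact h1.symm

end LocallyFinite

end TilingModel

namespace TilingModel

open Vertex

open SimpleGraph (edgeNeighbors cycleNeighbors layerBall exists_isCycle_iff_seq)

/-! ### Heights in the model -/

section Heights

variable {p q : ℕ}

/-- The height of a vertex: `0` for the centre, and `n + 1` for the vertices of `layer p q n`. -/
def height : Vertex p q → ℕ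
  | center => 0
  | node n _ => n + 1

/-- The number of neighbours of a vertex in the previous layer. -/
def numPar : Vertex p q → ℕ
  | center => 0
  | node n x => (layer p q n).par x

theorem height_downEnd (n : ℕ) (x : (layer p q n).C) (j : ℕ) : height (downEnd n x j).1 = n := by
  cases n with
  | zero => rfl
  | succ n => cases j <;> rfl

/-- The edges of the model, each in one of its directions: from a vertex to its successor in the
layer, or from a vertex to a neighbour in the previous layer. -/
inductive Step : Vertex p q → Vertex p q → Prop
  | next (n : ℕ) (x : (layer p q n).C) : Step (node n x) (node n ((layer p q n).next x))
  | down (n : ℕ) (x : (layer p q n).C) (j : ℕ) (hj : j < (layer p q n).par x) :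
      Step (node n x) (downEnd n x j).1

theorem modelGraph_adj_iff (hpq : Admissible p q) {x y : Vertex p q} :
    (modelGraph hpq).Adj x y ↔ Step x y ∨ Step y x := by
  have hq0 : NeZero q := ⟨by have := hpq.four_le; omega⟩
  have hstep : ∀ {x y : Vertex p q}, Step x y → (modelGraph hpq).Adj x y := by
    intro x y h
    rw [modelGraph_adj]
    cases h with
    | next n x =>
      refine ⟨?_, _, congrArg Prod.fst (flip_succDart hpq x)⟩
      intro h
      simp only [node.injEq, heq_eq_eq, true_and] at h
      exact (next_ne (by have := hpq.four_le; omega) n).1 x h.symm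
    | down n x j hj =>
      refine ⟨?_, _, congrArg Prod.fst (flip_parDart hpq x j hj)⟩
      intro h
      have := congrArg height h
      rw [height_downEnd] at this
      simp [height] at this
  refine ⟨?_, fun h => h.elim hstep fun h => (hstep h).symm⟩
  rintro ⟨-, i, rfl⟩
  refine dart_cases hpq (P := fun d => Step d.1 (flip d).1 ∨ Step (flip d).1 d.1) ?_ ?_ ?_ ?_ ?_
    (x, i)
  · intro t
    right
    exact Step.down 0 (spoke t 0 (Nat.zero_le _)) 0 (by rw [par_spoke]; simp)
  · intro n x
    right
    have := Step.next n ((layer p q n).next.symm x)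
    rw [Equiv.apply_symm_apply] at this
    rw [flip_predDart]
    exact this
  · intro n x t ht
    right
    have key : ∃ (y : (layer p q (n + 1)).C) (j : ℕ), j < (layer p q (n + 1)).par y ∧
        flip (rungDart x t) = parDart y j := by
      rw [flip_rungDart hpq x t ht]
      by_cases h : t * (p - 2) ≤ (layer p q n).block p q x
      · refine ⟨_, 0, ?_, upEnd_of_le x t h⟩
        rw [par_child, if_pos (Dvd.intro_left t rfl)]; split_ifs <;> omega
      · have h' : ¬ (p ≠ 3 ∨ t + 1 < (layer p q n).kids q x) := fun hc => h (mul_le_block hpq ht hc)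
        refine ⟨_, 1, ?_, upEnd_last x t h⟩
        rw [par_child]; simp [show p = 3 by tauto]
    obtain ⟨y, j, hj, hy⟩ := key
    have h2 := flip_parDart hpq y j hj
    rw [← hy, flip_flip hpq] at h2
    rw [hy, h2]
    exact Step.down _ y j hj
  · intro n x
    left
    rw [flip_succDart hpq]
    exact Step.next n x
  · intro n x j hj
    left
    rw [flip_parDart hpq x j hj]
    exact Step.down n x j hj

theorem Step.height_eq {x y : Vertex p q} (h : Step x y) :
    height x = height y ∨ height x = height y + 1 ∧ 0 < numPar x := by
  cases h with
  | next n x => left; rfl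
  | down n x j hj =>
    right
    rw [height_downEnd]
    exact ⟨rfl, by simp only [numPar]; omega⟩

/-- For `p > 3` every vertex has at most one neighbour in the previous layer. -/
theorem Step.unique_down (hp : p ≠ 3) {x y y' : Vertex p q} (h : Step x y) (h' : Step x y')
    (hy : height y < height x) (hy' : height y' < height x) : y = y' := by
  cases h with
  | next n x => simp [height] at hy
  | down n x j hj =>
    have := par_le_one hp n x
    obtain rfl : j = 0 := by omega
    cases h' with
    | next n x => simp [height] at hy'
    | down n x j hj =>
      obtain rfl : j = 0 := by omega
      rfl

theorem edgeNeighbors_height (hpq : Admissible p q) (n : ℕ) :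
    (modelGraph hpq).edgeNeighbors {v | height v ≤ n} =
      {v | height v = n + 1 ∧ 0 < numPar v} := by
  ext v
  simp only [edgeNeighbors, Set.mem_ofPred_eq, modelGraph_adj_iff]
  constructor
  · rintro ⟨h1, v', h2, h | h⟩
    · rcases h.height_eq with h3 | ⟨h3, h4⟩
      · omega
      · exact ⟨by omega, h4⟩
    · rcases h.height_eq with h3 | ⟨h3, h4⟩ <;> omega
  · rintro ⟨h1, h2⟩
    cases v with
    | center => simp [height] at h1
    | node m x =>
      simp only [height, Nat.add_right_cancel_iff] at h1
      subst h1
      refine ⟨by simp [height], (downEnd m x 0).1, (height_downEnd m x 0).le, Or.inl ?_⟩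
      exact Step.down m x 0 h2

/-! ### Short cycles of the model -/

theorem numPar_pos_of_eq_three (hp : p = 3) {v : Vertex p q} (hv : 0 < height v) : 0 < numPar v := by
  cases v with
  | center => simp [height] at hv
  | node n x =>
    simp only [numPar]
    cases n with
    | zero =>
      obtain ⟨t, i, h, rfl⟩ := exists_spoke x
      rw [par_spoke, if_pos (by omega)]; omega
    | succ n =>
      obtain ⟨v, i, h, rfl⟩ := exists_child x
      rw [par_child, if_pos (by simp [hp])]; split_ifs <;> omega

/-- For `p = 3` the second kind of vertices does not occur, since the vertices of a triangle are
adjacent. -/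
theorem cycleNeighbors_three {V : Type*} (G : SimpleGraph V) (A : Set V) :
    G.cycleNeighbors 3 A = ∅ := by
  rw [Set.eq_empty_iff_forall_notMem]
  rintro v ⟨h1, v', hv', h⟩
  obtain ⟨f, h0, h3, ⟨m, hm, hfm⟩, hadj, -⟩ := (exists_isCycle_iff_seq le_rfl).1 h
  apply h1
  by_cases hv : v ∈ A
  · exact Or.inl hv
  refine Or.inr ⟨hv, v', hv', ?_⟩
  subst hfm
  interval_cases m
  · rw [h0] at hv; exact absurd hv' hv
  · have := hadj 0 (by norm_num)
    rw [h0] at this; exact this.symm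
  · have := hadj 2 (by norm_num)
    rwa [h3] at this

/-- The map that sends the vertices of `layer p q H` to the vertices in whose blocks they lie, and
fixes the other vertices. -/
def collapse (H : ℕ) : Vertex p q → Vertex p q
  | center => center
  | node 0 x => node 0 x
  | node (n + 1) x => if n + 1 = H then node n x.1.1 else node (n + 1) x

theorem collapse_of_height_ne {H : ℕ} {v : Vertex p q} (h : height v ≠ H + 1) :
    collapse H v = v := by
  match v with
  | center => rfl
  | node 0 x => rfl
  | node (n + 1) x =>
    simp only [height, ne_eq, Nat.add_right_cancel_iff] at h
    simp [collapse, h]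

theorem height_collapse {H : ℕ} (hH : 0 < H) {v : Vertex p q} (h : height v = H + 1) :
    height (collapse H v) = H := by
  match v with
  | center => simp [height] at h
  | node 0 x => simp [height] at h; omega
  | node (n + 1) x =>
    simp only [height, Nat.add_right_cancel_iff] at h
    simp [collapse, h, height]

/-- The collapse of the top layer maps adjacent vertices to adjacent or equal ones. -/
theorem collapse_adj (hpq : Admissible p q) (hp : p ≠ 3) {H : ℕ} {x y : Vertex p q}
    (hx : height x ≤ H + 1) (hy : height y ≤ H + 1) (h : (modelGraph hpq).Adj x y) :
    collapse H x = collapse H y ∨ (modelGraph hpq).Adj (collapse H x) (collapse H y) := by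
  have key : ∀ {x y : Vertex p q}, height x ≤ H + 1 → Step x y →
      collapse H x = collapse H y ∨ (modelGraph hpq).Adj (collapse H x) (collapse H y) := by
    intro x y hx h
    rcases eq_or_lt_of_le hx with hx | hx
    · cases h with
      | next n x =>
        simp only [height, Nat.add_right_cancel_iff] at hx
        subst hx
        cases n with
        | zero => right; exact (modelGraph_adj_iff hpq).2 (Or.inl (Step.next 0 x))
        | succ n =>
          simp only [collapse, if_true]
          rcases odometer_fst (layer p q n).next ((layer p q n).block p q) x with e | e
          · left; exact congrArg (node n) e.symm
          · right
            have := Step.next n x.1.1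
            rw [← e] at this
            exact (modelGraph_adj_iff hpq).2 (Or.inl this)
      | down n x j hj =>
        have := par_le_one hp n x
        obtain rfl : j = 0 := by omega
        rw [collapse_of_height_ne (v := (downEnd n x 0).1)
          (by rw [height_downEnd]; simp [height] at hx; omega)]
        simp only [height, Nat.add_right_cancel_iff] at hx
        subst hx
        cases n with
        | zero => right; exact (modelGraph_adj_iff hpq).2 (Or.inl (Step.down 0 x 0 hj))
        | succ n => left; simp only [collapse, if_true]; rfl
    · have hy : height y < H + 1 := by
        rcases h.height_eq with h | h <;> omega
      rw [collapse_of_height_ne hx.ne, collapse_of_height_ne hy.ne]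
      exact Or.inr ((modelGraph_adj_iff hpq).2 (Or.inl h))
  rcases (modelGraph_adj_iff hpq).1 h with h | h
  · exact key hx h
  · rcases key hy h with h | h
    · exact Or.inl h.symm
    · exact Or.inr h.symm

/-- A sequence of vertices that stays at height `≥ N + 1` and starts and ends at this height can be
replaced by one of the same length that stays at this height. -/
theorem exists_flat_seq (hpq : Admissible p q) (hp : p ≠ 3) (N l K : ℕ) (f : ℕ → Vertex p q)
    (hf : ∀ i ≤ l, N + 1 ≤ height (f i) ∧ height (f i) ≤ N + 1 + K)
    (hadj : ∀ i < l, f i = f (i + 1) ∨ (modelGraph hpq).Adj (f i) (f (i + 1)))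
    (h0 : height (f 0) = N + 1) (hl : height (f l) = N + 1) :
    ∃ g : ℕ → Vertex p q, g 0 = f 0 ∧ g l = f l ∧ (∀ i ≤ l, height (g i) = N + 1) ∧
      ∀ i < l, g i = g (i + 1) ∨ (modelGraph hpq).Adj (g i) (g (i + 1)) := by
  induction K generalizing f with
  | zero => exact ⟨f, rfl, rfl, fun i hi => by have := hf i hi; omega, hadj⟩
  | succ K ih =>
    have e : ∀ v : Vertex p q, height v = N + 1 → collapse (N + 1 + K) v = v := fun v hv =>
      collapse_of_height_ne (by omega)
    have := ih (fun i => collapse (N + 1 + K) (f i)) ?_ ?_ (by rw [e _ h0, h0]) (by rw [e _ hl, hl])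
    · simpa only [e _ h0, e _ hl] using this
    · intro i hi
      have h := hf i hi
      by_cases hH : height (f i) = N + 1 + K + 1
      · rw [height_collapse (by omega) hH]; omega
      · rw [collapse_of_height_ne hH]; omega
    · intro i hi
      rcases hadj i hi with h | h
      · left; simp only [h]
      · exact collapse_adj hpq hp (hf i hi.le).2 (hf (i + 1) hi).2 h

/-- Two vertices of a layer with neighbours in the previous layer are at least `p - 3` steps
apart. -/
theorem par_next_iterate (hpq : Admissible p q) {n : ℕ} {x : (layer p q n).C}
    (hx : 0 < (layer p q n).par x) {j : ℕ} (hj : 0 < j) (hj' : j ≤ p - 4) :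
    (layer p q n).par ((layer p q n).next^[j] x) = 0 := by
  have hp3 := hpq.three_le
  cases n with
  | zero =>
    obtain ⟨t, i, h, rfl⟩ := exists_spoke x
    rw [par_spoke] at hx
    obtain rfl : i = 0 := by by_contra hc; simp [hc] at hx
    rw [next_iterate_spoke _ _ (by omega), par_spoke, if_neg (by omega)]
  | succ n =>
    obtain ⟨v, i, h, rfl⟩ := exists_child x
    rw [par_child] at hx
    obtain ⟨t, rfl⟩ : p - 2 ∣ i := by by_contra hc; simp [hc] at hx
    have hb := block_add_two hpq v
    have hk := lt_kids_of_mul_le_block hpq (by rwa [mul_comm] at h)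
    have hk' := Nat.mul_le_mul_right (p - 2) (Nat.succ_le_of_lt hk)
    rw [Nat.succ_mul, mul_comm t] at hk'
    rw [next_iterate_child _ _ (by omega), par_child, if_neg]
    intro hd
    have := Nat.le_of_dvd hj ((Nat.dvd_add_right (Dvd.intro t rfl)).1 hd)
    omega

theorem flat_seq_eq_zpow (hpq : Admissible p q) {N : ℕ} {x : (layer p q N).C} (l : ℕ)
    (g : ℕ → Vertex p q) (h0 : g 0 = node N x) (hh : ∀ i ≤ l, height (g i) = N + 1)
    (hadj : ∀ i < l, g i = g (i + 1) ∨ (modelGraph hpq).Adj (g i) (g (i + 1))) :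
    ∃ z : ℤ, z.natAbs ≤ l ∧ g l = node N (((layer p q N).next ^ z) x) := by
  induction l with
  | zero => exact ⟨0, le_rfl, by simpa using h0⟩
  | succ l ih =>
    obtain ⟨z, hz, hgl⟩ := ih (fun i hi => hh i (by omega)) fun i hi => hadj i (by omega)
    rcases hadj l (by omega) with h | h
    · exact ⟨z, by omega, by rw [← h, hgl]⟩
    · have h1 := hh (l + 1) le_rfl
      rw [hgl] at h
      generalize g (l + 1) = w at h h1
      rcases (modelGraph_adj_iff hpq).1 h with h | h
      · cases h with
        | next n x =>
          refine ⟨z + 1, by omega, ?_⟩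
          rw [add_comm, zpow_add, zpow_one, Equiv.Perm.mul_apply]
        | down n x j hj => rw [height_downEnd] at h1; omega
      · generalize hy : node N (((layer p q N).next ^ z) x) = y at h
        cases h with
        | next n y' =>
          simp only [height, Nat.add_right_cancel_iff] at h1
          subst h1
          simp only [node.injEq, heq_eq_eq, true_and] at hy
          refine ⟨z - 1, by omega, ?_⟩
          rw [sub_eq_neg_add, zpow_add, Equiv.Perm.mul_apply, hy, zpow_neg_one]
          exact congrArg _ ((layer p q _).next.symm_apply_apply y').symm
        | down n y' j hj =>
          have := congrArg height hy
          rw [height_downEnd] at this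
          simp only [height] at this h1
          omega

/-- An arc above a layer that joins two vertices with neighbours in the previous layer in at most
`p - 4` steps is closed. -/
theorem arc_closed (hpq : Admissible p q) (hp : p ≠ 3) {N l : ℕ} (hl : l ≤ p - 4)
    (f : ℕ → Vertex p q) (hf : ∀ i ≤ l, N + 1 ≤ height (f i))
    (hadj : ∀ i < l, (modelGraph hpq).Adj (f i) (f (i + 1)))
    (h0 : height (f 0) = N + 1) (hfl : height (f l) = N + 1)
    (h0' : 0 < numPar (f 0)) (hfl' : 0 < numPar (f l)) : f 0 = f l := by
  obtain ⟨g, hg0, hgl, hgh, hga⟩ := exists_flat_seq hpq hp N l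
    ((Finset.range (l + 1)).sup fun i => height (f i)) f
    (fun i hi => ⟨hf i hi, (Finset.le_sup (f := fun i => height (f i))
      (Finset.mem_range.2 (by omega) : i ∈ Finset.range (l + 1))).trans (by omega)⟩)
    (fun i hi => Or.inr (hadj i hi)) h0 hfl
  obtain ⟨x, hx⟩ : ∃ x, f 0 = node N x := by
    cases h : f 0 with
    | center => rw [h] at h0; simp [height] at h0
    | node n x =>
      rw [h] at h0
      simp only [height, Nat.add_right_cancel_iff] at h0
      subst h0
      exact ⟨x, rfl⟩
  obtain ⟨z, hz, hgz⟩ := flat_seq_eq_zpow hpq l g (hg0.trans hx) hgh hga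
  rw [hgl] at hgz
  rw [hx] at h0' ⊢
  rw [hgz] at hfl' ⊢
  simp only [numPar] at h0' hfl'
  rcases lt_trichotomy z 0 with h | h | h
  · -- going back, the last vertex is the one followed too early by the first
    have := par_next_iterate hpq hfl' (j := z.natAbs) (by omega) (by omega)
    rw [← Equiv.Perm.coe_pow, ← zpow_natCast, Int.natCast_natAbs, abs_of_neg h,
      ← Equiv.Perm.mul_apply, ← zpow_add, neg_add_cancel, zpow_zero, Equiv.Perm.one_apply] at this
    omega
  · rw [h]; simp
  · have := par_next_iterate hpq h0' (j := z.natAbs) (by omega) (by omega)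
    rw [← Equiv.Perm.coe_pow, ← zpow_natCast, Int.natCast_natAbs, abs_of_pos h] at this
    omega

theorem exists_last_le {h : ℕ → ℕ} {c m : ℕ} (h0 : h 0 ≤ c) (hm : c < h m) :
    ∃ k < m, h k ≤ c ∧ ∀ i, k < i → i ≤ m → c < h i := by
  induction m with
  | zero => omega
  | succ m ih =>
    rcases le_or_gt (h m) c with h' | h'
    · exact ⟨m, by omega, h', fun i h1 h2 => by obtain rfl : i = m + 1 := by omega
                                                exact hm⟩
    · obtain ⟨k, hk, hkc, hki⟩ := ih h'
      refine ⟨k, by omega, hkc, fun i h1 h2 => ?_⟩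
      rcases eq_or_lt_of_le h2 with rfl | h3
      · exact hm
      · exact hki i h1 (by omega)

/-- A cycle of length `p > 3` with a vertex of height at most `n` has height at most `n + 1`. -/
theorem height_le_of_cycle (hpq : Admissible p q) (hp : p ≠ 3) {n : ℕ} {f : ℕ → Vertex p q}
    (h0 : height (f 0) ≤ n) (hfp : f p = f 0)
    (hadj : ∀ i < p, (modelGraph hpq).Adj (f i) (f (i + 1))) (hinj : Set.InjOn f (Set.Iio p))
    {m : ℕ} (hm : m < p) : height (f m) ≤ n + 1 := by
  by_contra hc
  push Not at hc
  obtain ⟨k, hkm, hk, hki⟩ := exists_last_le (h := fun i => height (f i)) (c := n + 1) (m := m)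
    (by omega) hc
  obtain ⟨l, hlm, hl, hli⟩ := exists_last_le (h := fun i => height (f (p - i))) (c := n + 1)
    (m := p - m) (by rw [Nat.sub_zero, hfp]; omega) (by rwa [Nat.sub_sub_self hm.le])
  -- `x` and `y` are adjacent, and the edge between them crosses from height `n + 1` to `n + 2`
  have hcross : ∀ x y : Vertex p q, (modelGraph hpq).Adj x y → height x ≤ n + 1 →
      n + 1 < height y → Step y x ∧ height x = n + 1 ∧ height y = n + 2 ∧ 0 < numPar y := by
    intro x y hxy hx hy
    rcases (modelGraph_adj_iff hpq).1 hxy with h | h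
    · rcases h.height_eq with h1 | ⟨h1, h2⟩ <;> omega
    · rcases h.height_eq with h1 | ⟨h1, h2⟩
      · omega
      · exact ⟨h, by omega, by omega, h2⟩
  obtain ⟨a1, a2, a3, a4⟩ := hcross _ _ (hadj k (by omega)) hk (hki (k + 1) (by omega) (by omega))
  have hl1 := hadj (p - (l + 1)) (by omega)
  rw [show p - (l + 1) + 1 = p - l by omega] at hl1
  obtain ⟨b1, b2, b3, b4⟩ := hcross _ _ hl1.symm hl (hli (l + 1) (by omega) (by omega))
  have hk0 : 0 < k := by
    rcases Nat.eq_zero_or_pos k with h | h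
    · rw [h] at a2; omega
    · exact h
  have hl0 : 0 < l := by
    rcases Nat.eq_zero_or_pos l with h | h
    · rw [h, Nat.sub_zero, hfp] at b2; omega
    · exact h
  have harc := arc_closed hpq hp (N := n + 1) (l := p - (l + 1) - (k + 1)) (by omega)
    (fun i => f (k + 1 + i)) (fun i hi => by
      rcases le_or_gt (k + 1 + i) m with h | h
      · exact hki (k + 1 + i) (by omega) h
      · have := hli (p - (k + 1 + i)) (by omega) (by omega)
        rwa [Nat.sub_sub_self (by omega)] at this)
    (fun i hi => hadj (k + 1 + i) (by omega)) a3
    (by rw [show k + 1 + (p - (l + 1) - (k + 1)) = p - (l + 1) by omega, b3]) a4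
    (by rwa [show k + 1 + (p - (l + 1) - (k + 1)) = p - (l + 1) by omega])
  simp only [add_zero] at harc
  rw [show k + 1 + (p - (l + 1) - (k + 1)) = p - (l + 1) by omega] at harc
  rw [harc] at a1
  have := a1.unique_down hp b1 (by omega) (by omega)
  have := hinj (by simp only [Set.mem_Iio]; omega) (by simp only [Set.mem_Iio]; omega) this
  omega

/-- A path of `p - 1` vertices whose ends are adjacent to a further vertex gives a cycle of
length `p`. -/
theorem exists_isCycle_of_path {V : Type*} {G : SimpleGraph V} (hp : 3 ≤ p) (u : V) (g : ℕ → V)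
    (hinj : Set.InjOn g (Set.Iic (p - 2))) (hu : ∀ k ≤ p - 2, g k ≠ u)
    (hadj : ∀ k < p - 2, G.Adj (g k) (g (k + 1))) (h0 : G.Adj u (g 0)) (h1 : G.Adj (g (p - 2)) u)
    {k : ℕ} (hk : k ≤ p - 2) :
    ∃ (w : V) (c : G.Walk w w), c.IsCycle ∧ c.length = p ∧ g k ∈ c.support ∧ u ∈ c.support := by
  rw [exists_isCycle_iff_seq hp]
  refine ⟨fun i => if i = 0 ∨ i = p then u else g (i - 1), by simp, by simp,
    ⟨k + 1, by omega, ?_⟩, ?_, ?_⟩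
  · simp only
    rw [if_neg (by omega), Nat.add_sub_cancel]
  · intro i hi
    simp only
    rcases Nat.eq_zero_or_pos i with rfl | hi0
    · rw [if_pos (by simp), if_neg (by omega)]; exact h0
    · rw [if_neg (by omega)]
      by_cases hip : i + 1 = p
      · rw [if_pos (Or.inr hip), show i - 1 = p - 2 by omega]; exact h1
      · rw [if_neg (by omega)]
        have := hadj (i - 1) (by omega)
        rwa [Nat.sub_add_cancel hi0] at this
  · intro i hi j hj hij
    simp only [Set.mem_Iio] at hi hj hij
    split_ifs at hij with h1 h2 h2
    · omega
    · exact absurd hij.symm (hu _ (by omega))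
    · exact absurd hij (hu _ (by omega))
    · have := hinj (by simp only [Set.mem_Iic]; omega) (by simp only [Set.mem_Iic]; omega) hij
      omega

theorem adj_next (hpq : Admissible p q) {n : ℕ} (x : (layer p q n).C) :
    (modelGraph hpq).Adj (node n x) (node n ((layer p q n).next x)) :=
  (modelGraph_adj_iff hpq).2 (Or.inl (Step.next n x))

theorem adj_child (hpq : Admissible p q) {n : ℕ} (v : (layer p q n).C) (t : ℕ)
    (h : t * (p - 2) ≤ (layer p q n).block p q v) :
    (modelGraph hpq).Adj (node n v) (node (n + 1) (child v (t * (p - 2)) h)) := by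
  refine (modelGraph_adj_iff hpq).2 (Or.inr ?_)
  refine Step.down (n + 1) (child v (t * (p - 2)) h) 0 ?_
  rw [par_child, if_pos (Dvd.intro_left t rfl)]; split_ifs <;> omega

theorem adj_spoke (hpq : Admissible p q) (t : ZMod q) :
    (modelGraph hpq).Adj center (node 0 (spoke t 0 (Nat.zero_le _))) :=
  (modelGraph_adj_iff hpq).2 (Or.inr (Step.down 0 (spoke t 0 (Nat.zero_le _)) 0
    (by rw [par_spoke]; simp)))

/-- Every vertex without neighbours in the previous layer lies on a face that meets the previous
layer. -/
theorem exists_face_cycle (hpq : Admissible p q) (hp : p ≠ 3) {v : Vertex p q} {n : ℕ}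
    (hv : height v = n + 1) (hv' : numPar v = 0) :
    ∃ u, height u = n ∧ ∃ (w : Vertex p q) (c : (modelGraph hpq).Walk w w),
      c.IsCycle ∧ c.length = p ∧ v ∈ c.support ∧ u ∈ c.support := by
  have hp3 := hpq.three_le
  have hq4 := hpq.four_le
  have hq0 : NeZero q := ⟨by omega⟩
  have hnode : ∀ {n : ℕ} {x y : (layer p q n).C}, node n x = node n y → x = y := by
    intro n x y h
    simpa using h
  cases v with
  | center => simp [height] at hv
  | node m x =>
  simp only [height, Nat.add_right_cancel_iff] at hv
  subst hv
  simp only [numPar] at hv'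
  cases m with
  | zero =>
    obtain ⟨t, i, h, rfl⟩ := exists_spoke x
    refine ⟨center, rfl, ?_⟩
    have hlast : (layer p q 0).next^[p - 2] (spoke t 0 (Nat.zero_le _)) =
        spoke (t + 1) 0 (Nat.zero_le _) := by
      rw [show p - 2 = p - 3 + 1 by omega, Function.iterate_succ_apply',
        next_iterate_spoke _ _ (by omega), next_spoke_last _ (by omega)]
    have hiter : ∀ k (hk : k ≤ p - 3), (layer p q 0).next^[k] (spoke t 0 (Nat.zero_le _)) =
        spoke t k hk := by
      intro k hk
      rw [next_iterate_spoke _ _ (by omega)]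
      exact spoke_congr rfl (zero_add k)
    have := exists_isCycle_of_path (G := modelGraph hpq) hp3 center
      (fun k => node 0 ((layer p q 0).next^[k] (spoke t 0 (Nat.zero_le _)))) ?_
      (fun _ _ => by simp) (fun k _ => ?_) (adj_spoke hpq t) ?_ (k := i) (by omega)
    · simpa only [hiter i h] using this
    · have ht : t + 1 ≠ t := by
        have : Fact (1 < q) := ⟨by omega⟩
        simp
      intro k hk l hl hkl
      have hkl := hnode hkl
      simp only [Set.mem_Iic] at hk hl
      rcases Nat.lt_or_ge k (p - 2) with h1 | h1 <;> rcases Nat.lt_or_ge l (p - 2) with h2 | h2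
      · rw [hiter k (by omega), hiter l (by omega), spoke_inj] at hkl
        exact hkl.2
      · obtain rfl : l = p - 2 := by omega
        rw [hiter k (by omega), hlast, spoke_inj] at hkl
        exact absurd hkl.1.symm ht
      · obtain rfl : k = p - 2 := by omega
        rw [hiter l (by omega), hlast, spoke_inj] at hkl
        exact absurd hkl.1 ht
      · omega
    · rw [Function.iterate_succ_apply']; exact adj_next hpq _
    · simp only [hlast]; exact (adj_spoke hpq (t + 1)).symm
  | succ n =>
    obtain ⟨v, i, h, rfl⟩ := exists_child x
    refine ⟨node n v, rfl, ?_⟩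
    have hb := block_add_two hpq v
    rw [par_child] at hv'
    have hdvd : ¬ p - 2 ∣ i := by
      intro hc
      rw [if_pos hc] at hv'
      split_ifs at hv'
    have hr0 : 0 < i % (p - 2) := Nat.pos_of_ne_zero fun hc => hdvd (Nat.dvd_of_mod_eq_zero hc)
    have hr : i % (p - 2) < p - 2 := Nat.mod_lt _ (by omega)
    have hi : i / (p - 2) * (p - 2) + i % (p - 2) = i := by
      rw [mul_comm]; exact Nat.div_add_mod _ _
    generalize i / (p - 2) = t at hi
    generalize i % (p - 2) = r at hi hr hr0
    have ht : t * (p - 2) ≤ (layer p q n).block p q v := by omega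
    have htk := lt_kids_of_mul_le_block hpq ht
    have hx : ∀ k (hk : t * (p - 2) + k ≤ (layer p q n).block p q v),
        (layer p q (n + 1)).next^[k] (child v (t * (p - 2)) ht) = child v (t * (p - 2) + k) hk :=
      fun k hk => next_iterate_child k _ hk
    have hxi : (layer p q (n + 1)).next^[r] (child v (t * (p - 2)) ht) = child v i h := by
      rw [hx r (by omega)]; exact child_congr rfl hi
    rcases Nat.lt_or_ge (t + 1) ((layer p q n).kids q v) with htk' | htk'
    · -- the face between two edges from `v` to its block
      have ht1 := mul_le_block hpq htk' (Or.inl hp)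
      have ht1' : t * (p - 2) + (p - 2) ≤ (layer p q n).block p q v := by
        rwa [Nat.add_mul, one_mul] at ht1
      have := exists_isCycle_of_path (G := modelGraph hpq) hp3 (node n v)
        (fun k => node (n + 1) ((layer p q (n + 1)).next^[k] (child v (t * (p - 2)) ht))) ?_
        (fun _ _ hc => by simpa [height] using congrArg height hc) (fun k _ => ?_)
        (adj_child hpq v t ht) ?_ (k := r) (by omega)
      · simpa only [hxi] using this
      · intro k hk l hl hkl
        simp only [Set.mem_Iic] at hk hl
        have hkl := hnode hkl
        rw [hx k (by omega), hx l (by omega), child_inj] at hkl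
        omega
      · rw [Function.iterate_succ_apply']; exact adj_next hpq _
      · rw [hx _ ht1']
        have := adj_child hpq v (t + 1) ht1
        rw [child_congr (h' := ht1') rfl (by rw [Nat.add_mul, one_mul])] at this
        exact this.symm
    · -- the face between the last edge from `v` and the first edge from its successor
      have htk2 : t + 1 = (layer p q n).kids q v := by omega
      rw [← htk2, Nat.add_mul, one_mul] at hb
      have hlast : (layer p q (n + 1)).next^[p - 3] (child v (t * (p - 2)) ht) =
          child ((layer p q n).next v) 0 (Nat.zero_le _) := by
        rw [show p - 3 = p - 4 + 1 by omega, Function.iterate_succ_apply', hx (p - 4) (by omega),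
          next_child_last _ (by omega)]
      have hne := (next_ne (p := p) (q := q) (by omega) n).1 v
      have := exists_isCycle_of_path (G := modelGraph hpq) hp3 (node n v)
        (fun k => if k = p - 2 then node n ((layer p q n).next v) else
          node (n + 1) ((layer p q (n + 1)).next^[k] (child v (t * (p - 2)) ht))) ?_ ?_
        (fun k hk => ?_) ?_ ?_ (k := r) (by omega)
      · simpa only [if_neg hr.ne, hxi] using this
      · intro k hk l hl hkl
        simp only [Set.mem_Iic] at hk hl
        simp only at hkl
        split_ifs at hkl with h1 h2 h2
        · omega
        · simpa [height] using congrArg height hkl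
        · simpa [height] using congrArg height hkl
        · have hkl := hnode hkl
          rcases Nat.lt_or_ge k (p - 3) with h3 | h3 <;> rcases Nat.lt_or_ge l (p - 3) with h4 | h4
          · rw [hx k (by omega), hx l (by omega), child_inj] at hkl
            omega
          · obtain rfl : l = p - 3 := by omega
            rw [hx k (by omega), hlast, child_inj] at hkl
            exact absurd hkl.1.symm hne
          · obtain rfl : k = p - 3 := by omega
            rw [hx l (by omega), hlast, child_inj] at hkl
            exact absurd hkl.1 hne
          · omega
      · intro k hk hc
        split_ifs at hc with h1
        · exact hne (hnode hc)
        · simpa [height] using congrArg height hc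
      · rw [if_neg hk.ne]
        split_ifs with h1
        · rw [show k = p - 3 by omega, hlast]
          have := adj_child hpq ((layer p q n).next v) 0 (by simp)
          rw [child_congr (h' := Nat.zero_le _) rfl (zero_mul _)] at this
          exact this.symm
        · rw [Function.iterate_succ_apply']; exact adj_next hpq _
      · rw [if_neg (by omega)]
        exact adj_child hpq v t ht
      · simp only [if_true]
        exact (adj_next hpq v).symm

theorem cycleNeighbors_height (hpq : Admissible p q) (n : ℕ) :
    (modelGraph hpq).cycleNeighbors p {v | height v ≤ n} =
      {v | height v = n + 1 ∧ numPar v = 0} := by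
  by_cases hp : p = 3
  · have : {v : Vertex p q | height v = n + 1 ∧ numPar v = 0} = ∅ := by
      rw [Set.eq_empty_iff_forall_notMem]
      rintro v ⟨h1, h2⟩
      have := numPar_pos_of_eq_three hp (v := v) (by omega)
      omega
    rw [this]
    have h3 := cycleNeighbors_three (modelGraph hpq) {v | height v ≤ n}
    rw [← h3]
    congr 1
  · ext v
    simp only [cycleNeighbors, edgeNeighbors_height, Set.mem_ofPred_eq, Set.mem_union]
    constructor
    · rintro ⟨h1, v', hv', h⟩
      obtain ⟨f, h0, hfp, ⟨m, hm, hfm⟩, hadj, hinj⟩ := (exists_isCycle_iff_seq hpq.three_le).1 h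
      have := height_le_of_cycle hpq hp (n := n) (by rwa [h0]) (hfp.trans h0.symm) hadj hinj hm
      rw [hfm] at this
      omega
    · rintro ⟨h1, h2⟩
      obtain ⟨u, hu, h⟩ := exists_face_cycle hpq hp h1 h2
      exact ⟨by omega, u, hu.le, h⟩

/-- The layering around the centre of the model is given by the height. -/
theorem layerBall_model (hpq : Admissible p q) (n : ℕ) :
    (modelGraph hpq).layerBall p center n = {v | height v ≤ n} := by
  induction n with
  | zero =>
    ext v
    cases v <;> simp [layerBall, height]
  | succ n ih =>
    simp only [layerBall, ih, edgeNeighbors_height, cycleNeighbors_height]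
    ext v
    simp only [Set.mem_union, Set.mem_ofPred_eq]
    omega

end Heights

end TilingModel

namespace TilingModel

open Vertex

/-! ### Counting vertices and edges of the model -/

section Counting

/-- The blocks as a sigma type. -/
def blocksEquiv (C : Type) (m : C → ℕ) : Blocks C m ≃ Σ v : C, Fin (m v + 1) where
  toFun x := ⟨x.1.1, x.1.2, Nat.lt_succ_of_le x.2⟩
  invFun x := ⟨(x.1, x.2.val), Nat.le_of_lt_succ x.2.isLt⟩
  left_inv _ := rfl
  right_inv _ := rfl

instance finite_blocks (C : Type) [Finite C] (m : C → ℕ) : Finite (Blocks C m) :=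
  Finite.of_equiv _ (blocksEquiv C m).symm

theorem sum_blocks {C : Type} [Fintype C] (m : C → ℕ) [Fintype (Blocks C m)] (F : C × ℕ → ℕ) :
    ∑ x : Blocks C m, F x.1 = ∑ v, ∑ i ∈ Finset.range (m v + 1), F (v, i) := by
  rw [Fintype.sum_equiv (blocksEquiv C m) (fun x => F x.1) (fun y => F (y.1, y.2.val)) fun _ => rfl,
    Fintype.sum_sigma]
  exact Finset.sum_congr rfl fun v _ => (Finset.sum_range fun i => F (v, i)).symm

variable {p q : ℕ}

instance finite_layer [NeZero q] (n : ℕ) : Finite (layer p q n).C := by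
  induction n with
  | zero => exact finite_blocks (ZMod q) fun _ => p - 3
  | succ n ih => exact finite_blocks (layer p q n).C _

noncomputable instance fintype_layer [NeZero q] (n : ℕ) : Fintype (layer p q n).C :=
  Fintype.ofFinite _

/-- The number of vertices of a layer. -/
noncomputable def numVerts (p q : ℕ) [NeZero q] (n : ℕ) : ℕ := Fintype.card (layer p q n).C

/-- The number of edges between a layer and the previous one. -/
noncomputable def numRungs (p q : ℕ) [NeZero q] (n : ℕ) : ℕ := ∑ x, (layer p q n).par x

theorem numVerts_zero [NeZero q] (hp : 3 ≤ p) : numVerts p q 0 = q * (p - 2) := by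
  have : Fintype (Blocks (ZMod q) fun _ => p - 3) := Fintype.ofFinite _
  have h := sum_blocks (fun _ : ZMod q => p - 3) fun _ => 1
  simp only [Finset.sum_const, Finset.card_univ, Finset.card_range, smul_eq_mul, mul_one,
    ZMod.card] at h
  rw [show p - 3 + 1 = p - 2 by omega] at h
  rw [← h, numVerts]
  exact Fintype.card_congr (Equiv.refl _)

theorem numRungs_zero [NeZero q] : numRungs p q 0 = q := by
  let : Fintype (Blocks (ZMod q) fun _ => p - 3) := fintype_layer (p := p) (q := q) 0
  have h := sum_blocks (fun _ : ZMod q => p - 3) fun x => if x.2 = 0 then 1 else 0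
  simp only [Finset.sum_ite_eq', Finset.mem_range, Nat.succ_pos, if_true, Finset.sum_const,
    Finset.card_univ, smul_eq_mul, mul_one, ZMod.card] at h
  exact h

/-- The edges between `v` and the next layer, counted at their upper ends, except that for `p = 3`
the last edge of `v` is exchanged with the last edge of the predecessor of `v`. -/
theorem sum_par_block (hpq : Admissible p q) {n : ℕ} (v : (layer p q n).C) :
    (∑ i ∈ Finset.range ((layer p q n).block p q v + 1),
      if p - 2 ∣ i then (if p = 3 ∧ i = 0 then 2 else 1) else 0) = (layer p q n).kids q v := by
  have hb := block_add_two hpq v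
  have hp3 := hpq.three_le
  by_cases hp : p = 3
  · rw [show p - 2 = 1 by omega, mul_one] at hb
    have h : ∀ i, (if p - 2 ∣ i then (if p = 3 ∧ i = 0 then 2 else 1) else 0) =
        if i = 0 then 2 else 1 := by
      intro i
      rw [if_pos (by rw [show p - 2 = 1 by omega]; exact one_dvd i)]
      simp only [hp, true_and]
    simp only [h]
    rw [Finset.sum_range_succ', if_pos rfl, ← hb]
    simp
  · simp only [hp, false_and, if_false]
    rw [← Finset.card_filter]
    have : (Finset.range ((layer p q n).block p q v + 1)).filter (p - 2 ∣ ·) =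
        (Finset.range ((layer p q n).kids q v)).image (· * (p - 2)) := by
      ext i
      simp only [Finset.mem_filter, Finset.mem_range, Finset.mem_image]
      constructor
      · rintro ⟨h, t, rfl⟩
        exact ⟨t, lt_kids_of_mul_le_block hpq (by rw [mul_comm]; omega), mul_comm _ _⟩
      · rintro ⟨t, ht, rfl⟩
        exact ⟨Nat.lt_succ_of_le (mul_le_block hpq ht (Or.inl hp)), Dvd.intro_left t rfl⟩
    rw [this, Finset.card_image_of_injective, Finset.card_range]
    intro a b hab
    exact Nat.eq_of_mul_eq_mul_right (by omega) hab

theorem numRungs_succ_eq_sum [NeZero q] (hpq : Admissible p q) (n : ℕ) :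
    numRungs p q (n + 1) = ∑ v, (layer p q n).kids q v := by
  let : Fintype (Blocks (layer p q n).C ((layer p q n).block p q)) := fintype_layer (n + 1)
  have h := sum_blocks ((layer p q n).block p q) fun x =>
    if p - 2 ∣ x.2 then (if p = 3 ∧ x.2 = 0 then 2 else 1) else 0
  simp only [sum_par_block hpq] at h
  exact h

theorem numRungs_succ [NeZero q] (hpq : Admissible p q) (n : ℕ) :
    numRungs p q (n + 1) + numRungs p q n + 2 * numVerts p q n = q * numVerts p q n := by
  have h : ∑ v, ((layer p q n).kids q v + (layer p q n).par v + 2) =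
      ∑ _v : (layer p q n).C, q := Finset.sum_congr rfl fun v _ => kids_add hpq v
  simp only [Finset.sum_add_distrib, Finset.sum_const, Finset.card_univ, smul_eq_mul,
    ← numRungs_succ_eq_sum hpq] at h
  rw [mul_comm 2, mul_comm q]
  exact h

theorem numVerts_succ [NeZero q] (hpq : Admissible p q) (n : ℕ) :
    numVerts p q (n + 1) + numVerts p q n = (p - 2) * numRungs p q (n + 1) := by
  have : Fintype (Blocks (layer p q n).C ((layer p q n).block p q)) := Fintype.ofFinite _
  have h := sum_blocks ((layer p q n).block p q) fun _ => 1
  simp only [Finset.sum_const, Finset.card_univ, Finset.card_range, smul_eq_mul, mul_one] at h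
  have h1 : numVerts p q (n + 1) = ∑ v, ((layer p q n).block p q v + 1) := by
    rw [← h, numVerts]
    exact Fintype.card_congr (Equiv.refl _)
  have h2 : ∑ v, ((layer p q n).block p q v + 1 + 1) =
      ∑ v, (layer p q n).kids q v * (p - 2) := Finset.sum_congr rfl fun v _ => block_add_two hpq v
  rw [Finset.sum_add_distrib, ← h1, ← Finset.sum_mul, ← numRungs_succ_eq_sum hpq, mul_comm _ (p - 2),
    Finset.sum_const, Finset.card_univ, smul_eq_mul, mul_one] at h2
  exact h2

theorem ncard_height [NeZero q] (n : ℕ) (Q : ℕ → Prop) [DecidablePred Q] :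
    {v : Vertex p q | height v = n + 1 ∧ Q (numPar v)}.ncard =
      (Finset.univ.filter fun x : (layer p q n).C => Q ((layer p q n).par x)).card := by
  have : {v : Vertex p q | height v = n + 1 ∧ Q (numPar v)} =
      node n '' {x | Q ((layer p q n).par x)} := by
    ext v
    cases v with
    | center => simp [height]
    | node m x =>
      constructor
      · rintro ⟨h1, h2⟩
        simp only [height, Nat.add_right_cancel_iff] at h1
        subst h1
        exact ⟨x, h2, rfl⟩
      · rintro ⟨y, hy, h⟩
        rw [← h]
        exact ⟨rfl, hy⟩
  rw [this, Set.ncard_image_of_injective _ fun x y h => by simpa using h,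
    ← Set.ncard_coe_finset]
  simp

variable (hpq : Admissible p q)

theorem model_s_succ [NeZero q] (n : ℕ) :
    (modelGraph hpq).s p center (n + 1) = numVerts p q n := by
  have : (modelGraph hpq).layerVerts p center (n + 1) =
      {v | height v = n + 1 ∧ (fun _ => True) (numPar v)} := by
    simp only [SimpleGraph.layerVerts, layerBall_model]
    ext v
    simp only [Set.mem_sdiff, Set.mem_ofPred_eq, and_true]
    omega
  rw [SimpleGraph.s, this]
  refine (ncard_height n fun _ => True).trans ?_
  simp [numVerts]

theorem model_s₁_succ [NeZero q] (hp : p ≠ 3) (n : ℕ) :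
    (modelGraph hpq).s₁ p center (n + 1) = numRungs p q n := by
  rw [SimpleGraph.s₁, SimpleGraph.layerFirst, layerBall_model, edgeNeighbors_height,
    ncard_height n (0 < ·), numRungs, Finset.card_filter]
  refine Finset.sum_congr rfl fun x _ => ?_
  have := par_le_one hp n x
  split_ifs <;> omega

theorem model_s₂_succ [NeZero q] (hp : p ≠ 3) (n : ℕ) :
    (modelGraph hpq).s₂ p center (n + 1) + numRungs p q n = numVerts p q n := by
  rw [SimpleGraph.s₂, SimpleGraph.layerSecond, layerBall_model, cycleNeighbors_height,
    ncard_height n (· = 0), numRungs, Finset.card_filter, ← Finset.sum_add_distrib, numVerts,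
    ← Finset.card_univ, Finset.card_eq_sum_ones]
  refine Finset.sum_congr rfl fun x _ => ?_
  have := par_le_one hp n x
  split_ifs <;> omega

theorem downEnd_inj (hpq : Admissible p q) {n : ℕ} {x : (layer p q n).C} {j j' : ℕ}
    (hj : j < (layer p q n).par x) (hj' : j' < (layer p q n).par x)
    (h : (downEnd n x j).1 = (downEnd n x j').1) : j = j' := by
  have hq0 : NeZero q := ⟨by have := hpq.four_le; omega⟩
  have h2 := par_le_two n x
  cases n with
  | zero =>
    obtain ⟨t, i, hi, rfl⟩ := exists_spoke x
    rw [par_spoke] at hj hj'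
    split_ifs at hj hj' <;> omega
  | succ n =>
    have hne : ∀ v : (layer p q n).C, v ≠ (layer p q n).next.symm v := by
      intro v hv
      rw [Equiv.eq_symm_apply] at hv
      exact (next_ne (by have := hpq.four_le; omega) n).1 v hv
    rcases j with _ | j <;> rcases j' with _ | j'
    · rfl
    · simp only [downEnd, rungDart, node.injEq, heq_eq_eq, true_and] at h
      exact absurd h (hne _)
    · simp only [downEnd, rungDart, node.injEq, heq_eq_eq, true_and] at h
      exact absurd h.symm (hne _)
    · omega

/-- The edges with upper end in a layer: the edges inside the layer, one for each vertex, and the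
edges to the previous layer. -/
def layerEdge (n : ℕ) :
    (layer p q n).C ⊕ (Σ x : (layer p q n).C, Fin ((layer p q n).par x)) → Sym2 (Vertex p q)
  | Sum.inl x => s(node n x, node n ((layer p q n).next x))
  | Sum.inr x => s(node n x.1, (downEnd n x.1 x.2).1)

theorem layerEdge_injective (hpq : Admissible p q) (n : ℕ) :
    Function.Injective (layerEdge (p := p) (q := q) n) := by
  have hq0 : NeZero q := ⟨by have := hpq.four_le; omega⟩
  have hne := (next_ne (p := p) (q := q) (by have := hpq.four_le; omega) n).2
  have hd : ∀ (x y : (layer p q n).C) j, node n x ≠ (downEnd n y j).1 := by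
    intro x y j h
    have := congrArg height h
    rw [height_downEnd] at this
    simp [height] at this
  have hnode : ∀ {x y : (layer p q n).C}, node n x = node n y → x = y := by
    intro x y h
    simpa using h
  rintro (x | ⟨x, j⟩) (y | ⟨y, j'⟩) h
  · simp only [layerEdge, Sym2.eq_iff] at h
    rcases h with ⟨h1, -⟩ | ⟨h1, h2⟩
    · rw [hnode h1]
    · have h1 := hnode h1
      have h2 := hnode h2
      rw [h1] at h2
      exact absurd h2 (hne y)
  · simp only [layerEdge, Sym2.eq_iff] at h
    rcases h with ⟨-, h2⟩ | ⟨h1, -⟩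
    · exact absurd h2 (hd _ _ _)
    · exact absurd h1 (hd _ _ _)
  · simp only [layerEdge, Sym2.eq_iff] at h
    rcases h with ⟨-, h2⟩ | ⟨-, h2⟩
    · exact absurd h2.symm (hd _ _ _)
    · exact absurd h2.symm (hd _ _ _)
  · simp only [layerEdge, Sym2.eq_iff] at h
    rcases h with ⟨h1, h2⟩ | ⟨h1, -⟩
    · obtain rfl := hnode h1
      obtain rfl := Fin.ext (downEnd_inj hpq j.2 j'.2 h2)
      rfl
    · exact absurd h1 (hd _ _ _)

theorem range_layerEdge (n : ℕ) :
    (modelGraph hpq).layerEdges p center (n + 1) = Set.range (layerEdge n) := by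
  have key : ∀ v w : Vertex p q, Step v w → height v = n + 1 →
      s(v, w) ∈ Set.range (layerEdge (p := p) (q := q) n) := by
    intro v w h hv
    cases h with
    | next m x =>
      simp only [height, Nat.add_right_cancel_iff] at hv
      subst hv
      exact ⟨Sum.inl x, rfl⟩
    | down m x j hj =>
      simp only [height, Nat.add_right_cancel_iff] at hv
      subst hv
      exact ⟨Sum.inr ⟨x, j, hj⟩, rfl⟩
  apply Set.Subset.antisymm
  · intro e
    induction e with
    | h v w =>
      simp only [SimpleGraph.layerEdges, Set.mem_sdiff, SimpleGraph.mem_layerSubgraph_edgeSet,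
        layerBall_model, Set.mem_ofPred_eq, modelGraph_adj_iff]
      rintro ⟨⟨h1, h2, h | h⟩, h3⟩
      · refine key v w h ?_
        rcases h.height_eq with h4 | ⟨h4, -⟩ <;>
        · by_contra hc
          exact h3 ⟨by omega, by omega, Or.inl h⟩
      · rw [Sym2.eq_swap]
        refine key w v h ?_
        rcases h.height_eq with h4 | ⟨h4, -⟩ <;>
        · by_contra hc
          exact h3 ⟨by omega, by omega, Or.inr h⟩
  · rintro _ ⟨x | ⟨x, j⟩, rfl⟩
    · simp only [layerEdge, SimpleGraph.layerEdges, Set.mem_sdiff,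
        SimpleGraph.mem_layerSubgraph_edgeSet, layerBall_model, Set.mem_ofPred_eq,
        modelGraph_adj_iff]
      exact ⟨⟨le_rfl, le_rfl, Or.inl (Step.next n x)⟩, fun h => by simpa [height] using h.1⟩
    · simp only [layerEdge, SimpleGraph.layerEdges, Set.mem_sdiff,
        SimpleGraph.mem_layerSubgraph_edgeSet, layerBall_model, Set.mem_ofPred_eq,
        modelGraph_adj_iff]
      refine ⟨⟨le_rfl, ?_, Or.inl (Step.down n x j j.2)⟩, fun h => by simpa [height] using h.1⟩
      rw [height_downEnd]; omega

theorem model_b_succ [NeZero q] (n : ℕ) :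
    (modelGraph hpq).b p center (n + 1) = numVerts p q n + numRungs p q n := by
  rw [SimpleGraph.b, range_layerEdge, ← Set.image_univ,
    Set.ncard_image_of_injective _ (layerEdge_injective hpq n), Set.ncard_univ,
    Nat.card_eq_fintype_card, Fintype.card_sum, Fintype.card_sigma]
  simp [numVerts, numRungs]

end Counting

end TilingModel

open TilingModel

theorem mainTheorem4 (p q : ℕ) (hp : 3 ≤ p) (hq : 3 ≤ q)
    (hpq : (1 : ℝ) / p + 1 / q ≤ 1 / 2) (o : TilingVertex p q hp hq) :
    let G := tilingGraph p q hp hq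
    let s₁ : ℕ → ℤ := fun n => (G.s₁ p o n : ℤ)
    let s₂ : ℕ → ℤ := fun n => (G.s₂ p o n : ℤ)
    let s : ℕ → ℤ := fun n => (G.s p o n : ℤ)
    let b : ℕ → ℤ := fun n => (G.b p o n : ℤ)
    -- the graphs `G_n` are finite, so the cardinalities below are genuine
    (∀ n, (G.layerSubgraph p o n).verts.Finite ∧ (G.layerSubgraph p o n).edgeSet.Finite) ∧
    -- the layers add up to `G_n`
    (∀ n, ((G.layerSubgraph p o n).verts.ncard : ℤ) = ∑ k ∈ Finset.range (n + 1), s k) ∧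
    (∀ n, ((G.layerSubgraph p o n).edgeSet.ncard : ℤ) = ∑ k ∈ Finset.Icc 1 n, b k) ∧
    -- the case `p, q > 3`
    (3 < p → 3 < q →
      s₁ 1 = q ∧ s₂ 1 = ((p : ℤ) - 3) * q ∧ b 1 = ((p : ℤ) - 1) * q ∧
      ∀ n, 1 ≤ n →
        s n = s₁ n + s₂ n ∧
        s₁ (n + 1) = ((q : ℤ) - 3) * s₁ n + ((q : ℤ) - 2) * s₂ n ∧
        s₂ (n + 1) = ((p : ℤ) - 3) * (s₁ (n + 1) - s n) + ((p : ℤ) - 4) * s n ∧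
        b n = 2 * s₁ n + s₂ n) ∧
    -- the case `p = 3`
    (p = 3 →
      s 0 = 1 ∧ s 1 = q ∧ s 2 = (q : ℤ) * ((q : ℤ) - 4) ∧
      (∀ n, 2 ≤ n → s (n + 1) = ((q : ℤ) - 4) * s n - s (n - 1)) ∧
      (∀ n, 1 ≤ n → b (n + 1) = 2 * s (n + 1) + s n)) := by
  intro G s₁ s₂ s b
  have hq0 : NeZero q := ⟨by omega⟩
  have hfin := SimpleGraph.finite_layerBall G p o (finite_tilingGraph_adj hp hq) hp
  -- the recursions for the model, and the comparison of the layers of the model with those of `G`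
  have hR : Admissible p q → ∀ n, (numRungs p q (n + 1) : ℤ) =
      ((q : ℤ) - 2) * numVerts p q n - numRungs p q n := by
    intro ha n
    have := numRungs_succ ha n
    zify at this
    linarith
  have hV : Admissible p q → ∀ n, (numVerts p q (n + 1) : ℤ) =
      ((p : ℤ) - 2) * numRungs p q (n + 1) - numVerts p q n := by
    intro ha n
    have := numVerts_succ ha n
    zify [show 2 ≤ p by omega] at this
    linarith
  have hV0 : (numVerts p q 0 : ℤ) = q * ((p : ℤ) - 2) := by
    have := numVerts_zero (q := q) hp
    zify [show 2 ≤ p by omega] at this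
    exact this
  have hR0 : (numRungs p q 0 : ℤ) = q := by exact_mod_cast numRungs_zero
  have hs : Admissible p q → ∀ n, s (n + 1) = numVerts p q n := by
    intro ha n
    obtain ⟨e, he⟩ := exists_iso hp hq ha o
    have h := e.s_eq p o (n + 1)
    rw [he, model_s_succ ha] at h
    change (G.s p o (n + 1) : ℤ) = _
    exact_mod_cast h.symm
  have hb : Admissible p q → ∀ n, b (n + 1) = numVerts p q n + numRungs p q n := by
    intro ha n
    obtain ⟨e, he⟩ := exists_iso hp hq ha o
    have h := e.b_eq p o (n + 1)
    rw [he, model_b_succ ha] at h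
    change (G.b p o (n + 1) : ℤ) = _
    exact_mod_cast h.symm
  have hs₁ : Admissible p q → p ≠ 3 → ∀ n, s₁ (n + 1) = numRungs p q n := by
    intro ha hp3 n
    obtain ⟨e, he⟩ := exists_iso hp hq ha o
    have h := e.s₁_eq p o (n + 1)
    rw [he, model_s₁_succ ha hp3] at h
    change (G.s₁ p o (n + 1) : ℤ) = _
    exact_mod_cast h.symm
  have hs₂ : Admissible p q → p ≠ 3 → ∀ n, s₂ (n + 1) = numVerts p q n - numRungs p q n := by
    intro ha hp3 n
    obtain ⟨e, he⟩ := exists_iso hp hq ha o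
    have h := e.s₂_eq p o (n + 1)
    have h2 := model_s₂_succ ha hp3 n
    rw [← he, h] at h2
    rw [eq_sub_iff_add_eq]
    change (G.s₂ p o (n + 1) : ℤ) + _ = _
    exact_mod_cast h2
  refine ⟨fun n => ⟨hfin n, SimpleGraph.finite_layerSubgraph_edgeSet G p o (hfin n)⟩,
    fun n => ?_, fun n => ?_, fun hp' hq' => ?_, fun hp' => ?_⟩
  · have := SimpleGraph.ncard_layerBall G p o hfin n
    change ((G.layerBall p o n).ncard : ℤ) = ∑ k ∈ Finset.range (n + 1), (G.s p o k : ℤ)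
    exact_mod_cast this
  · have := SimpleGraph.ncard_layerSubgraph_edgeSet G p o hfin n
    change (_ : ℤ) = ∑ k ∈ Finset.Icc 1 n, (G.b p o k : ℤ)
    exact_mod_cast this
  · have ha : Admissible p q := Or.inl ⟨hp', hq'⟩
    have hp3 : p ≠ 3 := by omega
    refine ⟨?_, ?_, ?_, ?_⟩
    · rw [hs₁ ha hp3 0, hR0]
    · rw [hs₂ ha hp3 0, hR0, hV0]; ring
    · rw [hb ha 0, hR0, hV0]; ring
    · intro n hn
      obtain ⟨m, rfl⟩ := Nat.exists_eq_add_of_le' hn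
      rw [hs₁ ha hp3 (m + 1), hs₂ ha hp3 (m + 1), hs₁ ha hp3, hs₂ ha hp3, hs ha, hb ha, hV ha,
        hR ha]
      refine ⟨?_, ?_, ?_, ?_⟩ <;> ring
  · have hq6 : 6 ≤ q := by
      have h1 : (0 : ℝ) < q := by exact_mod_cast (by omega : 0 < q)
      have h2 : (6 : ℝ) ≤ q := by
        rw [hp'] at hpq
        have h3 : 1 / (q : ℝ) ≤ 1 / 6 := by push_cast at hpq; linarith
        rwa [one_div_le_one_div h1 (by norm_num)] at h3
      exact_mod_cast h2
    have ha : Admissible p q := Or.inr ⟨hp', hq6⟩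
    have hp3 : (p : ℤ) = 3 := by exact_mod_cast hp'
    rw [hp3] at hV hV0
    refine ⟨?_, ?_, ?_, ?_, ?_⟩
    · simp [s, SimpleGraph.s, SimpleGraph.layerVerts, SimpleGraph.layerBall]
    · rw [hs ha 0, hV0]; ring
    · rw [hs ha 1, hV ha, hR ha, hV0, hR0]; ring
    · intro n hn
      obtain ⟨m, rfl⟩ := Nat.exists_eq_add_of_le' hn
      rw [show m + 2 - 1 = m + 1 by omega, hs ha (m + 2), hs ha (m + 1), hs ha m]
      linarith [hV ha (m + 1), hR ha (m + 1), hV ha m]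
    · intro n hn
      obtain ⟨m, rfl⟩ := Nat.exists_eq_add_of_le' hn
      rw [hb ha (m + 1), hs ha (m + 1), hs ha m]
      linarith [hV ha m]
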